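/- Write $\dim$ for Hausdorff dimension. Let $n\ge 0$ and let $S=\bigcup_{i=1}^\infty S_i\subset\mathbb{R}^n$, where each $S_i$ is a nonempty subset of an affine subspace $V_i$ of $\mathbb{R}^n$ with $\dim S_i=\dim V_i$. For each $i$ let $W_i=(\operatorname{Span} V_i)^\perp$ be the orthogonal complement of the linear span of $V_i$, with codimension $\operatorname{codim}W_i=n-\dim W_i$. Let $d\in[0,n]$ be arbitrary. A scaled copy of $S$ centered at $x\in\mathbb{R}^n$ is a set of the form $x+rS=\{x+rs: s\in S\}$ with $r>0$. Then the smallest possible dimension of a set $A\subset\mathbb{R}^n$ that contains a scaled copy of $S$ centered at each point of some nonempty set $C\subset\mathbb{R}^n$ with $\dim C=d$ is $$\sup_i\bigl(\max(0,\,d-\operatorname{codim}W_i)+\dim S_i\bigr).$$ That is, every such $A$ has at least this dimension, and some such $A$ has exactly this dimension. Moreover, equality is already attained with a compact set $C$. -/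

import Mathlib

open scoped ENNReal

/-- The scaled copy `x + r S = {x + r s : s ∈ S}` of `S`, centred at `x` and of scale `r`. -/
def scaledCopy {n : ℕ} (x : EuclideanSpace ℝ (Fin n)) (r : ℝ)
    (S : Set (EuclideanSpace ℝ (Fin n))) : Set (EuclideanSpace ℝ (Fin n)) :=
  (fun s => x + r • s) '' S

/-- `A` contains a scaled copy of `S` (of some scale `r > 0`) centred at each point of `C`. -/
def ContainsScaledCopies {n : ℕ} (S C A : Set (EuclideanSpace ℝ (Fin n))) : Prop :=
  ∀ x ∈ C, ∃ r : ℝ, 0 < r ∧ scaledCopy x r S ⊆ A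

/-- The orthogonal complement of the linear span of an affine subspace `V`
(the span always contains the origin, even when `V` does not). -/
noncomputable def spanPerp {n : ℕ} (V : AffineSubspace ℝ (EuclideanSpace ℝ (Fin n))) :
    Submodule ℝ (EuclideanSpace ℝ (Fin n)) :=
  (Submodule.span ℝ (V : Set (EuclideanSpace ℝ (Fin n))))ᗮ

/-- The codimension of a linear subspace of Euclidean space. -/
noncomputable def codim {n : ℕ} (W : Submodule ℝ (EuclideanSpace ℝ (Fin n))) : ℕ :=
  Module.finrank ℝ (EuclideanSpace ℝ (Fin n) ⧸ W)

/-- The number `sup_i (max(0, d - codim W_i) + dim S_i)` with `W_i = Span{V_i}^⊥`,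
where `dim` is Hausdorff dimension. -/
noncomputable def copiesDim {n : ℕ} (T : ℕ → Set (EuclideanSpace ℝ (Fin n)))
    (V : ℕ → AffineSubspace ℝ (EuclideanSpace ℝ (Fin n))) (d : ℝ) : ℝ≥0∞ :=
  ⨆ i, (ENNReal.ofReal (max 0 (d - (codim (spanPerp (V i)) : ℝ))) + dimH (T i))

/-! Lower bound. Let `P` be the orthogonal projection to `W_i`. Since `S_i` lies in `Span V_i =
W_i^⊥`, a copy `x + r S_i` lies in the fibre of `P` over `P x`. So over each point of `P C` the
fibre of `A` has dimension at least `dim S_i`, and a slicing inequality valid for arbitrary sets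
(`LinearMap.add_le_dimH_of_fibres`, by pigeonhole on dyadic cubes) gives `dim A ≥ dim P C + dim
S_i`. Since `ker P` has dimension `codim W_i`, `dim P C ≥ max(0, d - codim W_i)`.

Upper bound. Take a compact `C` of dimension `d` whose projections to all the `W_i` are as small as
possible (`exists_isCompact_dimH_eq_and_dimH_projection_le`). It is a Cantor-type set whose digits
are grids adapted to one `W_i` at a time, each `i` recurring infinitely often; the scales shrink so
fast that at the right scales only the last digit counts.

The scales `r` of the copies are chosen generically (`exists_residual_scales`). If `0 ∈ V_i`, every
copy lies in `P⁻¹(P C)`, whose dimension is at most `dim P C + dim V_i`. If `0 ∉ V_i`, the span has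
one dimension too many. A linear `φ` with `φ = 1` on `V_i` then takes the constant value `φ x + r`
on the copy, and for residually many `r` this value falls in a set `Z` with `dim (P C × Z) ≤ dim P
C`, so the extra coordinate is free. By Baire a single `r` serves all `i`. -/

/-! ### Hausdorff dimension through countable covers by balls. -/

section Covers

open Metric MeasureTheory Filter
open scoped NNReal Topology

variable {X : Type*} [MetricSpace X]

/-- A set of Hausdorff dimension less than `s` has countable covers by balls with
arbitrarily small sum of the `s`-th powers of the radii. -/
theorem exists_ball_cover_of_dimH_lt [Nonempty X] {s : ℝ≥0} (hs : 0 < s) {A : Set X}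
    (hA : dimH A < s) {η : ℝ≥0∞} (hη : η ≠ 0) :
    ∃ (x : ℕ → X) (r : ℕ → ℝ≥0), (∀ i, 0 < r i) ∧ A ⊆ ⋃ i, ball (x i) (r i) ∧
      ∑' i, (r i : ℝ≥0∞) ^ (s : ℝ) < η := by
  borelize X
  have hs' : (0 : ℝ) < s := hs
  have h0 := hausdorffMeasure_of_dimH_lt hA
  rw [Measure.hausdorffMeasure_apply] at h0
  have h1 : (⨅ (t : ℕ → Set X) (_ : A ⊆ ⋃ n, t n) (_ : ∀ n, ediam (t n) ≤ 1),
      ∑' n, ⨆ _ : (t n).Nonempty, ediam (t n) ^ (s : ℝ)) = 0 :=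
    le_antisymm (h0 ▸ le_iSup₂ (f := fun (r : ℝ≥0∞) (_ : 0 < r) =>
      ⨅ (t : ℕ → Set X) (_ : A ⊆ ⋃ n, t n) (_ : ∀ n, ediam (t n) ≤ r),
      ∑' n, ⨆ _ : (t n).Nonempty, ediam (t n) ^ (s : ℝ)) 1 one_pos) bot_le
  have h2s : (2 : ℝ≥0∞) ^ (s : ℝ) ≠ 0 := by simp [ENNReal.rpow_eq_zero_iff]
  have h2t : (2 : ℝ≥0∞) ^ (s : ℝ) ≠ ∞ := by simp
  set κ : ℝ≥0∞ := η / 2 ^ (s : ℝ) / 2 with hκ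
  have hκ0 : κ ≠ 0 := by
    simp only [hκ, ne_eq, ENNReal.div_eq_zero_iff, hη, h2t, or_self, not_false_eq_true,
      ENNReal.ofNat_ne_top]
  have hlt := h1.trans_lt (pos_iff_ne_zero.2 hκ0)
  simp only [iInf_lt_iff] at hlt
  obtain ⟨t, htA, htd, htsum⟩ := hlt
  obtain ⟨ξ, hξ0, hξ⟩ := ENNReal.exists_pos_sum_of_countable hκ0 ℕ
  obtain ⟨x0⟩ := ‹Nonempty X›
  have hx : ∀ n, ∃ x, (t n).Nonempty → x ∈ t n := fun n => by
    by_cases h : (t n).Nonempty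
    · exact ⟨h.some, fun _ => h.some_mem⟩
    · exact ⟨x0, fun h' => (h h').elim⟩
  choose x hx using hx
  -- A covering set may have diameter zero. The padding `ξ n ^ (1 / s)` keeps the radii positive and
  -- adds less than `κ` to the sum; doubling the radius passes to open balls and costs `2 ^ s`.
  let b : ℕ → ℝ≥0 := fun n => max (ediam (t n)).toNNReal (ξ n ^ (1 / (s : ℝ)))
  have hb0 : ∀ n, 0 < b n := fun n => lt_max_of_lt_right (NNReal.rpow_pos (hξ0 n))
  refine ⟨x, fun n => 2 * b n, fun n => mul_pos two_pos (hb0 n), fun y hy => ?_, ?_⟩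
  · obtain ⟨n, hn⟩ := Set.mem_iUnion.1 (htA hy)
    refine Set.mem_iUnion.2 ⟨n, ?_⟩
    have hne : (t n).Nonempty := ⟨y, hn⟩
    have hfin : ediam (t n) ≠ ∞ := ne_top_of_le_ne_top ENNReal.one_ne_top (htd n)
    have h1 : edist y (x n) ≤ b n := by
      refine (edist_le_ediam_of_mem hn (hx n hne)).trans ?_
      rw [← ENNReal.coe_toNNReal hfin]
      refine ENNReal.coe_le_coe.2 (le_max_left _ _)
    rw [edist_nndist, ENNReal.coe_le_coe] at h1
    rw [mem_ball, ← coe_nndist, NNReal.coe_lt_coe]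
    exact h1.trans_lt (lt_mul_of_one_lt_left (hb0 n) one_lt_two)
  · have hterm : ∀ n, ((2 * b n : ℝ≥0) : ℝ≥0∞) ^ (s : ℝ) ≤
        2 ^ (s : ℝ) * ((⨆ _ : (t n).Nonempty, ediam (t n) ^ (s : ℝ)) + ξ n) := by
      intro n
      rw [ENNReal.coe_mul, ENNReal.mul_rpow_of_nonneg _ _ hs'.le]
      refine mul_le_mul' (by simp) ?_
      rcases max_choice (ediam (t n)).toNNReal (ξ n ^ (1 / (s : ℝ))) with h | h
      · refine le_add_right ?_
        change ((max _ _ : ℝ≥0) : ℝ≥0∞) ^ (s : ℝ) ≤ _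
        rw [h]
        rw [ENNReal.coe_toNNReal (ne_top_of_le_ne_top ENNReal.one_ne_top (htd n))]
        rcases (t n).eq_empty_or_nonempty with hne | hne
        · simp [hne, hs]
        · simp [hne]
      · refine le_add_left ?_
        change ((max _ _ : ℝ≥0) : ℝ≥0∞) ^ (s : ℝ) ≤ _
        rw [h, ← ENNReal.coe_rpow_of_nonneg _ hs'.le, ← NNReal.rpow_mul,
          one_div_mul_cancel hs'.ne', NNReal.rpow_one]
    calc ∑' n, ((2 * b n : ℝ≥0) : ℝ≥0∞) ^ (s : ℝ)
        ≤ ∑' n, 2 ^ (s : ℝ) * ((⨆ _ : (t n).Nonempty, ediam (t n) ^ (s : ℝ)) + ξ n) :=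
          ENNReal.tsum_le_tsum hterm
      _ = 2 ^ (s : ℝ) * ((∑' n, ⨆ _ : (t n).Nonempty, ediam (t n) ^ (s : ℝ)) + ∑' n, (ξ n : ℝ≥0∞)) := by
          rw [ENNReal.tsum_mul_left, ENNReal.tsum_add]
      _ < 2 ^ (s : ℝ) * (κ + κ) :=
          (ENNReal.mul_lt_mul_iff_right h2s h2t).2 (ENNReal.add_lt_add htsum hξ)
      _ = η := by
          rw [hκ, ENNReal.add_halves, ENNReal.mul_div_cancel h2s h2t]

/-- Finite version of `exists_ball_cover_of_dimH_lt` for compact sets. -/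
theorem IsCompact.exists_finset_ball_cover_of_dimH_lt [Nonempty X] {s : ℝ≥0} (hs : 0 < s)
    {A : Set X} (hc : IsCompact A) (hA : dimH A < s) {η : ℝ≥0∞} (hη : η ≠ 0) :
    ∃ (x : ℕ → X) (r : ℕ → ℝ≥0) (F : Finset ℕ), (∀ i, 0 < r i) ∧
      A ⊆ ⋃ i ∈ F, ball (x i) (r i) ∧ ∑ i ∈ F, (r i : ℝ≥0∞) ^ (s : ℝ) < η := by
  obtain ⟨x, r, hr, hcov, hsum⟩ := exists_ball_cover_of_dimH_lt hs hA hη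
  obtain ⟨F, hF⟩ := hc.elim_finite_subcover _ (fun i => isOpen_ball) hcov
  exact ⟨x, r, F, hr, hF, (ENNReal.sum_le_tsum F).trans_lt hsum⟩

/-- A set having countable covers by closed balls with arbitrarily small sum of the `s`-th powers
of the radii has Hausdorff dimension at most `s`. -/
theorem dimH_le_of_closedBall_cover {s : ℝ≥0} (hs : 0 < s) {A : Set X}
    (h : ∀ η : ℝ≥0, 0 < η → ∃ (ι : Type) (_ : Countable ι) (x : ι → X) (r : ι → ℝ≥0),
      A ⊆ ⋃ i, closedBall (x i) (r i) ∧ ∑' i, (r i : ℝ≥0∞) ^ (s : ℝ) ≤ η) :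
    dimH A ≤ s := by
  borelize X
  have hs' : (0 : ℝ) < s := hs
  have hη0 : ∀ k : ℕ, (0 : ℝ≥0) < ((k : ℝ≥0) + 1)⁻¹ := fun k => by positivity
  choose ι hι x r hcov hsum using fun k : ℕ => h _ (hη0 k)
  have hlim : Tendsto (fun k : ℕ => ((((k : ℝ≥0) + 1)⁻¹ : ℝ≥0) : ℝ≥0∞)) atTop (𝓝 0) := by
    rw [← ENNReal.coe_zero, ENNReal.tendsto_coe]
    simpa using tendsto_one_div_add_atTop_nhds_zero_nat (𝕜 := ℝ≥0)
  -- No mesh condition is assumed: each radius satisfies `r ^ s ≤ η`, so a small sum already forces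
  -- small balls.
  have hlim2 : Tendsto (fun k : ℕ => 2 * ((((k : ℝ≥0) + 1)⁻¹ : ℝ≥0) : ℝ≥0∞) ^ (1 / (s : ℝ)))
      atTop (𝓝 0) := by
    have h1 := ((ENNReal.continuous_rpow_const (y := 1 / (s : ℝ))).tendsto 0).comp hlim
    rw [ENNReal.zero_rpow_of_pos (by positivity)] at h1
    simpa using ENNReal.Tendsto.const_mul h1 (Or.inr ENNReal.ofNat_ne_top)
  have hdiam : ∀ k i, ediam (closedBall (x k i) (r k i)) ≤ 2 * (r k i : ℝ≥0∞) := fun k i => by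
    rw [← closedEBall_coe]; exact ediam_closedEBall_le
  have key : μH[(s : ℝ)] A ≤ liminf (fun k => ∑' i, ediam (closedBall (x k i) (r k i)) ^ (s : ℝ)) atTop := by
    refine Measure.hausdorffMeasure_le_liminf_tsum _ _ _ hlim2 _
      (Eventually.of_forall fun k i => ?_) (Eventually.of_forall fun k => hcov k)
    refine (hdiam k i).trans (mul_le_mul_right ?_ _)
    have : (r k i : ℝ≥0∞) ^ (s : ℝ) ≤ ((((k : ℝ≥0) + 1)⁻¹ : ℝ≥0) : ℝ≥0∞) :=
      (ENNReal.le_tsum i).trans (hsum k)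
    rwa [one_div, ENNReal.le_rpow_inv_iff hs']
  have hz : Tendsto (fun k => ∑' i, ediam (closedBall (x k i) (r k i)) ^ (s : ℝ)) atTop (𝓝 0) := by
    have h2 : Tendsto (fun k : ℕ => (2 : ℝ≥0∞) ^ (s : ℝ) * ((((k : ℝ≥0) + 1)⁻¹ : ℝ≥0) : ℝ≥0∞))
        atTop (𝓝 0) := by
      simpa using ENNReal.Tendsto.const_mul hlim (Or.inr (by simp : (2 : ℝ≥0∞) ^ (s : ℝ) ≠ ∞))
    refine tendsto_of_tendsto_of_tendsto_of_le_of_le tendsto_const_nhds h2 (fun _ => bot_le)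
      fun k => ?_
    calc ∑' i, ediam (closedBall (x k i) (r k i)) ^ (s : ℝ)
        ≤ ∑' i, 2 ^ (s : ℝ) * (r k i : ℝ≥0∞) ^ (s : ℝ) := ENNReal.tsum_le_tsum fun i => by
          rw [← ENNReal.mul_rpow_of_nonneg _ _ hs'.le]
          exact ENNReal.rpow_le_rpow (hdiam k i) hs'.le
      _ ≤ _ := by
          rw [ENNReal.tsum_mul_left]
          exact mul_le_mul_right (hsum k) _
  rw [hz.liminf_eq] at key
  exact dimH_le_of_hausdorffMeasure_ne_top (ne_top_of_le_ne_top ENNReal.zero_ne_top key)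

/-- A set of Hausdorff dimension greater than `s` has no cheap covers by closed balls. -/
theorem exists_le_tsum_of_lt_dimH {s : ℝ≥0} (hs : 0 < s) {A : Set X} (hA : s < dimH A) :
    ∃ η : ℝ≥0, 0 < η ∧ ∀ (ι : Type) [Countable ι] (x : ι → X) (r : ι → ℝ≥0),
      A ⊆ ⋃ i, closedBall (x i) (r i) → (η : ℝ≥0∞) < ∑' i, (r i : ℝ≥0∞) ^ (s : ℝ) := by
  contrapose! hA
  refine dimH_le_of_closedBall_cover hs fun η hη => ?_
  obtain ⟨ι, hι, x, r, h⟩ := hA η hη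
  exact ⟨ι, hι, x, r, h⟩

end Covers

/-! ### Dimension of preimages under linear maps. -/

section Fibres

open Metric MeasureTheory Filter
open scoped NNReal Topology

/-- Over a ball of radius `r`, a bounded box in `ℝ ^ k` splits into about `r ^ (-k)` cubes of size
`r`, which raises the exponent of the cover from `s` to `s + k`. -/
theorem dimH_prod_univ_pi_le {Y : Type*} [MetricSpace Y] (G : Set Y) (k : ℕ) :
    dimH (G ×ˢ (Set.univ : Set (Fin k → ℝ))) ≤ dimH G + k := by
  rcases isEmpty_or_nonempty Y with hY | hY
  · simp [Set.eq_empty_of_isEmpty]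
  by_contra! hlt
  obtain ⟨s, hs1, hs2⟩ := ENNReal.lt_iff_exists_nnreal_btwn.1 (lt_tsub_iff_right.2 hlt)
  rw [lt_tsub_iff_right] at hs2
  refine hs2.not_ge ?_
  have hs : 0 < s := ENNReal.coe_pos.1 (bot_le.trans_lt hs1)
  have hcov : G ×ˢ (Set.univ : Set (Fin k → ℝ)) ⊆
      ⋃ R : ℕ, G ×ˢ {c : Fin k → ℝ | ∀ j, |c j| ≤ R} := by
    rintro ⟨y, c⟩ ⟨hy, -⟩
    obtain ⟨R, hR⟩ := exists_nat_ge ‖c‖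
    exact Set.mem_iUnion.2 ⟨R, hy, fun j => (norm_le_pi_norm c j).trans hR⟩
  refine (dimH_mono hcov).trans ?_
  rw [dimH_iUnion]
  refine iSup_le fun R => ?_
  rw [show (s : ℝ≥0∞) + k = ((s + k : ℝ≥0) : ℝ≥0∞) by push_cast; rfl]
  refine dimH_le_of_closedBall_cover (by positivity) fun η hη => ?_
  -- For `r ≤ 1` the number of cubes per coordinate satisfies `(2⌈R / r⌉ + 1) r ≤ 2R + 3r ≤ 2R + 3`.
  set K : ℝ≥0 := (2 * R + 3) ^ k with hK
  have hK0 : 0 < K := by positivity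
  obtain ⟨x, r, hr, hc, hsum⟩ := exists_ball_cover_of_dimH_lt hs hs1
    (η := ((min (η / K) 1 : ℝ≥0) : ℝ≥0∞)) (by positivity)
  have hr1 : ∀ i, r i ≤ 1 := fun i => by
    have h1 : (r i : ℝ≥0∞) ^ (s : ℝ) ≤ 1 :=
      (ENNReal.le_tsum i).trans (hsum.le.trans (ENNReal.coe_le_coe.2 (min_le_right _ _)))
    by_contra! h
    exact h1.not_gt (ENNReal.one_lt_rpow (by exact_mod_cast h) (by exact_mod_cast hs))
  let M : ℕ → ℕ := fun i => ⌈(R : ℝ) / r i⌉₊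
  let F : ℕ → Finset (Fin k → ℤ) := fun i => Fintype.piFinset fun _ => Finset.Icc (-(M i : ℤ)) (M i)
  refine ⟨Σ i, F i, inferInstance, fun p => (x p.1, fun j => r p.1 * ((p.2 : Fin k → ℤ) j : ℝ)),
    fun p => r p.1, ?_, ?_⟩
  · rintro ⟨y, c⟩ ⟨hy, hcR⟩
    obtain ⟨i, hi⟩ := Set.mem_iUnion.1 (hc hy)
    have hri : (0 : ℝ) < r i := hr i
    have hq : (fun j => ⌊c j / r i⌋) ∈ F i := by
      refine Fintype.mem_piFinset.2 fun j => Finset.mem_Icc.2 ⟨?_, ?_⟩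
      · rw [Int.le_floor]
        push_cast
        have : (R : ℝ) / r i ≤ M i := Nat.le_ceil _
        have h2 : -((R : ℝ) / r i) ≤ c j / r i := by
          rw [← neg_div]
          exact div_le_div_of_nonneg_right (neg_le_of_abs_le (hcR j)) hri.le
        linarith
      · have : (⌊c j / r i⌋ : ℝ) ≤ M i := (Int.floor_le _).trans
          ((div_le_div_of_nonneg_right (le_of_abs_le (hcR j)) hri.le).trans (Nat.le_ceil _))
        exact_mod_cast this
    refine Set.mem_iUnion.2 ⟨⟨i, _, hq⟩, ?_⟩
    rw [mem_closedBall, Prod.dist_eq]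
    refine max_le (mem_ball.1 hi).le ((dist_pi_le_iff hri.le).2 fun j => ?_)
    rw [Real.dist_eq, abs_le]
    have h1 : r i * (c j / r i) = c j := mul_div_cancel₀ _ hri.ne'
    have h2 := mul_le_mul_of_nonneg_left (Int.floor_le (c j / r i)) hri.le
    have h3 := mul_le_mul_of_nonneg_left (Int.lt_floor_add_one (c j / r i)).le hri.le
    dsimp only
    constructor <;> nlinarith
  · have hcard : ∀ i, ((F i).card : ℝ≥0) * r i ^ k ≤ K := fun i => by
      have h1 : ((F i).card : ℝ≥0) = (2 * M i + 1) ^ k := by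
        simp only [F, Fintype.card_piFinset, Int.card_Icc, Finset.prod_const, Finset.card_univ,
          Fintype.card_fin]
        rw [show ((M i : ℤ) + 1 - -(M i : ℤ)).toNat = 2 * M i + 1 by omega]
        push_cast; rfl
      rw [h1, ← mul_pow, hK]
      refine pow_le_pow_left' ?_ k
      have h2 : (M i : ℝ) < R / r i + 1 := Nat.ceil_lt_add_one (by positivity)
      have hri : (0 : ℝ) < r i := hr i
      have h3 : (R : ℝ) / r i * r i = R := div_mul_cancel₀ _ hri.ne'
      have h4 : (r i : ℝ) ≤ 1 := hr1 i
      rw [← NNReal.coe_le_coe]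
      push_cast
      nlinarith
    calc ∑' p : Σ i, F i, (r p.1 : ℝ≥0∞) ^ ((s + k : ℝ≥0) : ℝ)
        = ∑' i, ((F i).card : ℝ≥0∞) * (r i : ℝ≥0∞) ^ ((s + k : ℝ≥0) : ℝ) := by
          rw [ENNReal.tsum_sigma (fun i (_ : F i) => (r i : ℝ≥0∞) ^ ((s + k : ℝ≥0) : ℝ))]
          simp
      _ ≤ ∑' i, (K : ℝ≥0∞) * (r i : ℝ≥0∞) ^ (s : ℝ) := ENNReal.tsum_le_tsum fun i => by
          have h0 : (r i : ℝ≥0∞) ≠ 0 := by simpa using (hr i).ne'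
          rw [NNReal.coe_add, ENNReal.rpow_add _ _ h0 ENNReal.coe_ne_top, mul_comm (_ ^ (s : ℝ)),
            ← mul_assoc, NNReal.coe_natCast, ENNReal.rpow_natCast]
          gcongr
          exact_mod_cast hcard i
      _ ≤ K * ((min (η / K) 1 : ℝ≥0) : ℝ≥0∞) := by
          rw [ENNReal.tsum_mul_left]; gcongr
      _ ≤ η := by
          rw [← ENNReal.coe_mul, ENNReal.coe_le_coe]
          calc K * min (η / K) 1 ≤ K * (η / K) := by gcongr; exact min_le_left _ _
            _ = η := mul_div_cancel₀ _ hK0.ne'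

/-- The preimage of `G` under a linear map has dimension at most that of `G` plus the dimension of
the kernel. -/
theorem dimH_preimage_linearMap_le {X Y : Type*} [NormedAddCommGroup X] [NormedSpace ℝ X]
    [FiniteDimensional ℝ X] [NormedAddCommGroup Y] [NormedSpace ℝ Y] (f : X →ₗ[ℝ] Y) (G : Set Y) :
    dimH (f ⁻¹' G) ≤ dimH G + Module.finrank ℝ (LinearMap.ker f) := by
  -- A linear retraction onto the kernel supplies the missing coordinates: paired with `f` it is
  -- injective, hence antilipschitz.
  obtain ⟨p, hp⟩ := (LinearMap.ker f).subtype.exists_leftInverse_of_injective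
    (LinearMap.ker f).ker_subtype
  let g : X →ₗ[ℝ] (Fin (Module.finrank ℝ (LinearMap.ker f)) → ℝ) :=
    (Module.finBasis ℝ (LinearMap.ker f)).equivFun.toLinearMap ∘ₗ p
  have hinj : LinearMap.ker (f.prod g) = ⊥ := by
    rw [LinearMap.ker_eq_bot']
    intro x hx
    simp only [LinearMap.prod_apply, Function.prod_apply, Prod.mk_eq_zero] at hx
    have h1 : p x = 0 := by simpa [g] using hx.2
    have h2 : p x = _ := LinearMap.congr_fun hp ⟨x, hx.1⟩
    rw [h1] at h2
    exact (congrArg Subtype.val h2).symm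
  obtain ⟨K, -, hK⟩ := (f.prod g).exists_antilipschitzWith hinj
  calc dimH (f ⁻¹' G) = dimH ((f.prod g) ⁻¹' (G ×ˢ Set.univ)) := by
        congr 1; ext; simp
    _ ≤ _ := (hK.dimH_preimage_le _).trans (dimH_prod_univ_pi_le _ _)

end Fibres

/-! ### The slicing inequality for arbitrary sets. -/

section Slicing

open Metric MeasureTheory Filter
open scoped NNReal Topology

theorem floor_mem_Icc_floor {a b K : ℝ} (h : |a - b| ≤ K) :
    ⌊a⌋ ∈ Finset.Icc (⌊b⌋ - (⌈K⌉₊ + 1 : ℕ)) (⌊b⌋ + (⌈K⌉₊ + 1 : ℕ)) := by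
  have h1 := Nat.le_ceil K
  have h2 := Int.floor_le a
  have h3 := Int.lt_floor_add_one a
  have h4 := Int.floor_le b
  have h5 := Int.lt_floor_add_one b
  have h6 := abs_le.1 h
  refine Finset.mem_Icc.2 ⟨?_, ?_⟩
  · have : (⌊b⌋ : ℝ) - (⌈K⌉₊ + 1) < ⌊a⌋ + 1 := by linarith
    have : ⌊b⌋ - ((⌈K⌉₊ : ℤ) + 1) < ⌊a⌋ + 1 := by exact_mod_cast this
    push_cast
    omega
  · have : (⌊a⌋ : ℝ) < ⌊b⌋ + (⌈K⌉₊ + 1) := by linarith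
    have : ⌊a⌋ < ⌊b⌋ + ((⌈K⌉₊ : ℤ) + 1) := by exact_mod_cast this
    push_cast
    omega

/-- The pigeonhole step of the slicing theorem: points over which every cover of the fibre of `A`
is uniformly expensive form a set of dimension at most `s` if `dimH A < s + τ`, where `τ` is
smaller than the exponent `t` measuring the covers of the fibres. -/
theorem dimH_le_of_expensive_fibres {X : Type*} [MetricSpace X] [Nonempty X] {p : ℕ}
    {f : X → Fin p → ℝ} {K : ℝ≥0} (hf : LipschitzWith K f) {A : Set X} {E : Set (Fin p → ℝ)}
    {s t τ κ : ℝ≥0} (hs : 0 < s) (hτt : τ < t) (hκ : 0 < κ)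
    (hA : dimH A < ((s + τ : ℝ≥0) : ℝ≥0∞))
    (hE : ∀ w ∈ E, ∀ (ι : Type) [Countable ι] (x : ι → X) (r : ι → ℝ≥0),
      A ∩ f ⁻¹' {w} ⊆ ⋃ i, closedBall (x i) (r i) → (κ : ℝ≥0∞) < ∑' i, (r i : ℝ≥0∞) ^ (t : ℝ)) :
    dimH E ≤ s := by
  classical
  obtain ⟨δ, hδ, rfl⟩ : ∃ δ : ℝ≥0, 0 < δ ∧ t = τ + δ :=
    ⟨t - τ, tsub_pos_of_lt hτt, (add_tsub_cancel_of_le hτt.le).symm⟩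
  have hu : 0 < s + τ := by positivity
  have hu' : (0 : ℝ) < ((s + τ : ℝ≥0) : ℝ) := hu
  let ρ : ℕ → ℝ≥0 := fun l => (2⁻¹ : ℝ≥0) ^ l
  have hρ0 : ∀ l, 0 < ρ l := fun l => by positivity
  have hρ0' : ∀ l, (ρ l : ℝ≥0∞) ≠ 0 := fun l => by simpa using (hρ0 l).ne'
  have hhlt : ((2⁻¹ : ℝ≥0) : ℝ≥0∞) ^ (δ : ℝ) < 1 :=
    ENNReal.rpow_lt_one (by exact_mod_cast (by norm_num : (2⁻¹ : ℝ≥0) < 1)) hδ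
  -- The gap `δ = t - τ` makes the sum over dyadic levels geometric, with value `c⁻¹`.
  set c : ℝ≥0∞ := 1 - ((2⁻¹ : ℝ≥0) : ℝ≥0∞) ^ (δ : ℝ) with hc
  have hc0 : c ≠ 0 := (tsub_pos_of_lt hhlt).ne'
  have hct : c ≠ ∞ := ne_top_of_le_ne_top ENNReal.one_ne_top tsub_le_self
  have hgeom : c * ∑' l, (ρ l : ℝ≥0∞) ^ (δ : ℝ) ≤ 1 := by
    have : ∀ l, (ρ l : ℝ≥0∞) ^ (δ : ℝ) = (((2⁻¹ : ℝ≥0) : ℝ≥0∞) ^ (δ : ℝ)) ^ l := fun l => by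
      simp only [ρ]
      rw [ENNReal.coe_pow, ← ENNReal.rpow_natCast, ← ENNReal.rpow_mul, mul_comm,
        ENNReal.rpow_mul, ENNReal.rpow_natCast]
    simp_rw [this]
    rw [ENNReal.tsum_geometric]
    exact ENNReal.mul_inv_le_one _
  -- A ball of radius `ρ` maps into a cube of half-side `K ρ`; the extra `1` allows for rounding to
  -- grid cells.
  set N : ℕ := ⌈(K : ℝ)⌉₊ + 1 with hN
  set b : ℝ≥0∞ := κ * c with hb
  have hb0 : b ≠ 0 := mul_ne_zero (by simpa using hκ.ne') hc0
  have hbt : b ≠ ∞ := ENNReal.mul_ne_top ENNReal.coe_ne_top hct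
  set M : ℝ≥0∞ := ((2 * N + 1) ^ p : ℕ) * 2 ^ ((s + τ : ℝ≥0) : ℝ) with hM
  have hM0 : M ≠ 0 := mul_ne_zero (by positivity) (by simp [ENNReal.rpow_eq_zero_iff])
  have hMt : M ≠ ∞ := ENNReal.mul_ne_top (ENNReal.natCast_ne_top _) (by simp)
  refine dimH_le_of_closedBall_cover hs fun η hη => ?_
  obtain ⟨x, r, hr, hcov, hsum⟩ := exists_ball_cover_of_dimH_lt hu hA
    (η := min (b * η / M) 1) (by
      simp [hb0, hMt, hη.ne', min_eq_iff, ENNReal.div_eq_zero_iff])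
  have hr1 : ∀ i, r i ≤ 1 := fun i => by
    have h1 : (r i : ℝ≥0∞) ^ ((s + τ : ℝ≥0) : ℝ) ≤ 1 :=
      (ENNReal.le_tsum i).trans (hsum.le.trans (min_le_right _ _))
    by_contra! h
    exact h1.not_gt (ENNReal.one_lt_rpow (by exact_mod_cast h) hu')
  have hlev : ∀ i, ∃ l, ρ (l + 1) < r i ∧ r i ≤ ρ l := fun i =>
    exists_nat_pow_near_of_lt_one (hr i) (hr1 i) (by norm_num) (by norm_num)
  choose l hl1 hl2 using hlev
  let Q : ℕ → Finset (Fin p → ℤ) := fun i =>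
    Fintype.piFinset fun j => Finset.Icc (⌊f (x i) j / ρ (l i)⌋ - N) (⌊f (x i) j / ρ (l i)⌋ + N)
  have hQcard : ∀ i, (Q i).card = (2 * N + 1) ^ p := fun i => by
    simp only [Q, Fintype.card_piFinset, Int.card_Icc]
    rw [Finset.prod_congr rfl (g := fun _ => 2 * N + 1) (fun j _ => by omega)]
    simp
  -- `m a` counts the covering balls of level `a.1` whose image may meet the grid cube `a.2`. The
  -- cubes with `m > b ρ ^ (-τ)` cover `E`: over a point `w` outside them, at most `b ρ ^ (-τ)`
  -- balls of each level are needed, so the fibre has a cover of cost at most `b ∑ ρ ^ δ ≤ κ`. They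
  -- are also cheap, since each ball is counted by boundedly many cubes.
  let m : ℕ × (Fin p → ℤ) → ℝ≥0∞ := fun a => ∑' i, if l i = a.1 ∧ a.2 ∈ Q i then 1 else 0
  refine ⟨{a : ℕ × (Fin p → ℤ) // b < m a * (ρ a.1 : ℝ≥0∞) ^ (τ : ℝ)}, inferInstance,
    fun a j => a.1.2 j * ρ a.1.1, fun a => ρ a.1.1, fun w hw => ?_, ?_⟩
  · have hexp := hE w hw {i // w ∈ f '' closedBall (x i) (ρ (l i))} (fun i => x i)
      (fun i => ρ (l i)) (by
        rintro y ⟨hyA, hyw⟩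
        obtain ⟨i, hi⟩ := Set.mem_iUnion.1 (hcov hyA)
        have hi' : y ∈ closedBall (x i) (ρ (l i)) :=
          closedBall_subset_closedBall (hl2 i) (ball_subset_closedBall hi)
        exact Set.mem_iUnion.2 ⟨⟨i, y, hi', hyw⟩, hi'⟩)
    let q : ℕ → Fin p → ℤ := fun k j => ⌊w j / ρ k⌋
    have hmem : ∀ i, w ∈ f '' closedBall (x i) (ρ (l i)) → q (l i) ∈ Q i := by
      rintro i ⟨y, hy, rfl⟩
      refine Fintype.mem_piFinset.2 fun j => floor_mem_Icc_floor ?_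
      have hpos : (0 : ℝ) < ρ (l i) := hρ0 _
      rw [← sub_div, abs_div, abs_of_pos hpos, div_le_iff₀ hpos, ← Real.dist_eq]
      exact (dist_le_pi_dist _ _ j).trans ((hf.dist_le_mul _ _).trans
        (mul_le_mul_of_nonneg_left (mem_closedBall.1 hy) K.coe_nonneg))
    by_contra hno
    have hsmall : ∀ k, m (k, q k) * (ρ k : ℝ≥0∞) ^ (τ : ℝ) ≤ b := by
      intro k
      by_contra! hk
      refine hno (Set.mem_iUnion.2 ⟨⟨(k, q k), hk⟩, ?_⟩)
      have hpos : (0 : ℝ) < ρ k := hρ0 _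
      refine mem_closedBall.2 ((dist_pi_le_iff hpos.le).2 fun j => ?_)
      rw [Real.dist_eq, abs_le]
      have h1 : w j / ρ k * ρ k = w j := div_mul_cancel₀ _ hpos.ne'
      have h2 := mul_le_mul_of_nonneg_right (Int.floor_le (w j / ρ k)) hpos.le
      have h3 := mul_le_mul_of_nonneg_right (Int.lt_floor_add_one (w j / ρ k)).le hpos.le
      dsimp only [q]
      constructor <;> nlinarith
    refine hexp.not_ge ?_
    calc ∑' i : {i // w ∈ f '' closedBall (x i) (ρ (l i))}, (ρ (l i) : ℝ≥0∞) ^ ((τ + δ : ℝ≥0) : ℝ)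
        ≤ ∑' i, ∑' k, (if l i = k ∧ q k ∈ Q i then 1 else 0) * (ρ k : ℝ≥0∞) ^ ((τ + δ : ℝ≥0) : ℝ) := by
          refine (tsum_subtype {i | w ∈ f '' closedBall (x i) (ρ (l i))}
            (fun i => (ρ (l i) : ℝ≥0∞) ^ ((τ + δ : ℝ≥0) : ℝ))).trans_le ?_
          refine ENNReal.tsum_le_tsum fun i => ?_
          refine Set.indicator_apply_le' (fun hi => ?_) fun _ => zero_le
          refine le_trans ?_ (ENNReal.le_tsum (l i))
          simp [hmem i hi]
      _ = ∑' k, m (k, q k) * (ρ k : ℝ≥0∞) ^ ((τ + δ : ℝ≥0) : ℝ) := by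
          rw [ENNReal.tsum_comm]
          exact tsum_congr fun k => ENNReal.tsum_mul_right
      _ ≤ ∑' k, b * (ρ k : ℝ≥0∞) ^ (δ : ℝ) := ENNReal.tsum_le_tsum fun k => by
          rw [NNReal.coe_add, ENNReal.rpow_add _ _ (hρ0' k) ENNReal.coe_ne_top, ← mul_assoc]
          gcongr
          exact hsmall k
      _ = κ * (c * ∑' k, (ρ k : ℝ≥0∞) ^ (δ : ℝ)) := by
          rw [ENNReal.tsum_mul_left, hb, mul_assoc]
      _ ≤ κ := mul_le_of_le_one_right' hgeom
  · calc ∑' a : {a : ℕ × (Fin p → ℤ) // b < m a * (ρ a.1 : ℝ≥0∞) ^ (τ : ℝ)},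
          (ρ a.1.1 : ℝ≥0∞) ^ (s : ℝ)
        ≤ ∑' a : ℕ × (Fin p → ℤ), b⁻¹ * (m a * (ρ a.1 : ℝ≥0∞) ^ ((s + τ : ℝ≥0) : ℝ)) := by
          refine (tsum_subtype {a : ℕ × (Fin p → ℤ) | b < m a * (ρ a.1 : ℝ≥0∞) ^ (τ : ℝ)}
            (fun a => (ρ a.1 : ℝ≥0∞) ^ (s : ℝ))).trans_le ?_
          refine ENNReal.tsum_le_tsum fun a =>
            Set.indicator_apply_le' (fun ha => ?_) fun _ => zero_le
          rw [add_comm s, NNReal.coe_add, ENNReal.rpow_add _ _ (hρ0' a.1) ENNReal.coe_ne_top,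
            ← mul_assoc (m a), ← mul_assoc]
          refine le_mul_of_one_le_left' ?_
          rw [← ENNReal.inv_mul_cancel hb0 hbt]
          gcongr
          exact le_of_lt ha
      _ = b⁻¹ * ∑' i, ∑' a : ℕ × (Fin p → ℤ), (if l i = a.1 ∧ a.2 ∈ Q i then 1 else 0) *
            (ρ a.1 : ℝ≥0∞) ^ ((s + τ : ℝ≥0) : ℝ) := by
          rw [ENNReal.tsum_mul_left, ENNReal.tsum_comm]
          congr 1
          exact tsum_congr fun a => ENNReal.tsum_mul_right.symm
      _ ≤ b⁻¹ * ∑' i, M * (r i : ℝ≥0∞) ^ ((s + τ : ℝ≥0) : ℝ) := by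
          gcongr with i
          rw [tsum_eq_sum (s := {l i} ×ˢ Q i) (fun a ha => by
            have : ¬ (l i = a.1 ∧ a.2 ∈ Q i) := fun h => ha (by simp [h.1, h.2])
            simp [this])]
          have hρr : (ρ (l i) : ℝ≥0∞) ≤ 2 * r i := by
            have h1 := hl1 i
            simp only [ρ, pow_succ] at h1
            have h2 : ρ (l i) ≤ 2 * r i := by
              calc ρ (l i) = 2 * (2⁻¹ ^ l i * 2⁻¹) := by
                    rw [mul_comm (2⁻¹ ^ l i), ← mul_assoc, mul_inv_cancel₀ two_ne_zero, one_mul]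
                _ ≤ 2 * r i := by gcongr
            exact_mod_cast h2
          calc ∑ a ∈ {l i} ×ˢ Q i, (if l i = a.1 ∧ a.2 ∈ Q i then (1 : ℝ≥0∞) else 0) *
                (ρ a.1 : ℝ≥0∞) ^ ((s + τ : ℝ≥0) : ℝ)
              = ∑ a ∈ {l i} ×ˢ Q i, (ρ (l i) : ℝ≥0∞) ^ ((s + τ : ℝ≥0) : ℝ) := by
                refine Finset.sum_congr rfl fun a ha => ?_
                simp only [Finset.mem_product, Finset.mem_singleton] at ha
                simp [ha.1, ha.2]
            _ = ((2 * N + 1) ^ p : ℕ) * (ρ (l i) : ℝ≥0∞) ^ ((s + τ : ℝ≥0) : ℝ) := by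
                rw [Finset.sum_const, Finset.card_product, hQcard, Finset.card_singleton, one_mul,
                  nsmul_eq_mul]
            _ ≤ M * (r i : ℝ≥0∞) ^ ((s + τ : ℝ≥0) : ℝ) := by
                rw [hM, mul_assoc, ← ENNReal.mul_rpow_of_nonneg _ _ hu'.le]
                gcongr
      _ ≤ b⁻¹ * (M * (b * η / M)) := by
          rw [ENNReal.tsum_mul_left]
          gcongr
          exact hsum.le.trans (min_le_left _ _)
      _ = η := by
          rw [ENNReal.mul_div_cancel hM0 hMt, ← mul_assoc, ENNReal.inv_mul_cancel hb0 hbt, one_mul]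

/-- If all fibres over `E` of the set `A` under a Lipschitz map to `ℝ ^ p` have dimension at least
`t`, then `A` has dimension at least `dimH E + t`. -/
theorem LipschitzWith.add_le_dimH_of_fibres {X : Type*} [MetricSpace X] {p : ℕ}
    {f : X → Fin p → ℝ} {K : ℝ≥0} (hf : LipschitzWith K f) {A : Set X} {E : Set (Fin p → ℝ)}
    {t : ℝ≥0∞} (hEA : E ⊆ f '' A) (hE : E.Nonempty) (h : ∀ w ∈ E, t ≤ dimH (A ∩ f ⁻¹' {w})) :
    dimH E + t ≤ dimH A := by
  obtain ⟨w0, hw0⟩ := hE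
  obtain ⟨x0, hx0, -⟩ := hEA hw0
  have : Nonempty X := ⟨x0⟩
  rcases eq_or_ne t 0 with rfl | ht
  · rw [add_zero]
    exact (dimH_mono hEA).trans (hf.dimH_image_le A)
  rcases eq_or_ne (dimH E) 0 with hE0 | hE0
  · rw [hE0, zero_add]
    exact (h w0 hw0).trans (dimH_mono Set.inter_subset_left)
  by_contra! hlt
  obtain ⟨a, ha, a', ha', haa⟩ := ENNReal.exists_lt_add_of_lt_add hlt hE0 ht
  obtain ⟨s, has, hsE⟩ := ENNReal.lt_iff_exists_nnreal_btwn.1 ha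
  obtain ⟨t', hat, htt⟩ := ENNReal.lt_iff_exists_nnreal_btwn.1 ha'
  have hs : 0 < s := ENNReal.coe_pos.1 (bot_le.trans_lt has)
  have ht' : 0 < t' := ENNReal.coe_pos.1 (bot_le.trans_lt hat)
  -- The maximum with `s` ensures `u ≥ s`, so that `τ = u - s` exists.
  have hAst : max (dimH A) s < ((s + t' : ℝ≥0) : ℝ≥0∞) := by
    refine max_lt (haa.trans_le ?_) (ENNReal.coe_lt_coe.2 (lt_add_of_pos_right _ ht'))
    rw [ENNReal.coe_add]
    exact add_le_add has.le hat.le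
  obtain ⟨u, hu1, hu2⟩ := ENNReal.lt_iff_exists_nnreal_btwn.1 hAst
  obtain ⟨τ, rfl⟩ := exists_add_of_le
    (ENNReal.coe_le_coe.1 ((le_max_right _ _).trans hu1.le) : s ≤ u)
  have hτ : τ < t' := lt_of_add_lt_add_left (ENNReal.coe_lt_coe.1 hu2)
  have hfib : ∀ w ∈ E, ∃ η : ℝ≥0, 0 < η ∧ ∀ (ι : Type) [Countable ι] (x : ι → X) (r : ι → ℝ≥0),
      A ∩ f ⁻¹' {w} ⊆ ⋃ i, closedBall (x i) (r i) → (η : ℝ≥0∞) < ∑' i, (r i : ℝ≥0∞) ^ (t' : ℝ) :=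
    fun w hw => exists_le_tsum_of_lt_dimH ht' (htt.trans_le (h w hw))
  choose! η hη0 hη using hfib
  -- The lower bound on the cost of covers depends on the fibre. Countable stability of dimension
  -- reduces to pieces on which it is uniform.
  have hcov : E ⊆ ⋃ k : ℕ, {w ∈ E | (1 : ℝ≥0) / (k + 1) ≤ η w} := by
    intro w hw
    obtain ⟨k, hk⟩ := exists_nat_one_div_lt (hη0 w hw)
    exact Set.mem_iUnion.2 ⟨k, hw, hk.le⟩
  refine hsE.not_ge ((dimH_mono hcov).trans ?_)
  rw [dimH_iUnion]
  refine iSup_le fun k => dimH_le_of_expensive_fibres hf hs hτ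
    (κ := 1 / (k + 1)) (by positivity) ((le_max_left _ _).trans_lt hu1) ?_
  intro w hw ι _ x r hc
  exact (ENNReal.coe_le_coe.2 hw.2).trans_lt (hη w hw.1 ι x r hc)

/-- If all fibres over `E` of the set `A` under a linear map have dimension at least `t`, then `A`
has dimension at least `dimH E + t`. -/
theorem LinearMap.add_le_dimH_of_fibres {X Y : Type*} [NormedAddCommGroup X] [NormedSpace ℝ X]
    [FiniteDimensional ℝ X] [NormedAddCommGroup Y] [NormedSpace ℝ Y] [FiniteDimensional ℝ Y]
    (f : X →ₗ[ℝ] Y) {A : Set X} {E : Set Y} {t : ℝ≥0∞} (hEA : E ⊆ f '' A) (hE : E.Nonempty)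
    (h : ∀ w ∈ E, t ≤ dimH (A ∩ f ⁻¹' {w})) : dimH E + t ≤ dimH A := by
  let e : Y ≃L[ℝ] (Fin (Module.finrank ℝ Y) → ℝ) :=
    (Module.finBasis ℝ Y).equivFun.toContinuousLinearEquiv
  let g := e.toContinuousLinearMap.comp f.toContinuousLinearMap
  rw [← e.dimH_image]
  refine g.lipschitz.add_le_dimH_of_fibres ?_ (hE.image _) ?_
  · rintro _ ⟨y, hy, rfl⟩
    obtain ⟨x, hx, rfl⟩ := hEA hy
    exact ⟨x, hx, rfl⟩
  · rintro _ ⟨y, hy, rfl⟩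
    refine (h y hy).trans (dimH_mono ?_)
    rintro x ⟨hx, rfl⟩
    exact ⟨hx, rfl⟩

end Slicing

/-! ### A generic set of reals that adds no dimension to a product. -/

section ResidualFactor

open Metric MeasureTheory Filter
open scoped NNReal Topology

/-- A compact set `E` has a residual set `Z` of reals such that `E × Z` has the dimension of `E`. -/
theorem IsCompact.exists_residual_dimH_prod_le {Y : Type*} [MetricSpace Y] {E : Set Y}
    (hE : IsCompact E) : ∃ Z ∈ residual ℝ, dimH (E ×ˢ Z) ≤ dimH E := by
  rcases eq_or_ne (dimH E) ∞ with htop | htop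
  · exact ⟨Set.univ, univ_mem, htop ▸ le_top⟩
  rcases isEmpty_or_nonempty Y with hY | hY
  · exact ⟨Set.univ, univ_mem, by simp [Set.eq_empty_of_isEmpty]⟩
  obtain ⟨D, hD⟩ : ∃ D : ℝ≥0, (D : ℝ≥0∞) = dimH E := ⟨_, ENNReal.coe_toNNReal htop⟩
  let σ : ℕ → ℝ≥0 := fun j => D + 1 / (j + 1)
  have hσ0 : ∀ j, 0 < σ j := fun j => by positivity
  have hσ : ∀ j, dimH E < σ j := fun j => by
    rw [← hD, ENNReal.coe_lt_coe]
    exact lt_add_of_pos_right _ (by positivity)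
  have hω0 : ∀ j : ℕ, ((1 / (j + 1) : ℝ≥0) : ℝ≥0∞) ≠ 0 := fun j => by
    simp only [ne_eq, ENNReal.coe_eq_zero]; positivity
  choose ω hωpos hωsum using fun j : ℕ =>
    ENNReal.exists_pos_sum_of_countable (ε := ((1 / (j + 1) : ℝ≥0) : ℝ≥0∞)) (hω0 j) ℚ
  choose x r F hr hcov hsum using fun (j : ℕ) (q : ℚ) =>
    hE.exists_finset_ball_cover_of_dimH_lt (hσ0 j) (hσ j) (η := ω j q)
      (by simpa using (hωpos j q).ne')
  have hmin : ∀ j q, ∃ ε : ℝ, 0 < ε ∧ ∀ i ∈ F j q, ε ≤ r j q i := fun j q => by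
    rcases (F j q).eq_empty_or_nonempty with h | h
    · exact ⟨1, one_pos, by simp [h]⟩
    · obtain ⟨i, -, hi⟩ := (F j q).exists_min_image (r j q) h
      exact ⟨r j q i, hr j q i, fun i' hi' => hi i' hi'⟩
  choose ε hε0 hε using hmin
  -- The interval about `q` is no wider than the smallest ball of the `q`-th finite cover of `E`, so
  -- those balls, as balls of the product, also cover `E` times the interval. Compactness makes this
  -- smallest radius positive, and the costs `ω j q` are summable over `q`.
  refine ⟨⋂ j, ⋃ q : ℚ, ball (q : ℝ) (ε j q), ?_, ?_⟩
  · refine countable_iInter_mem.2 fun j =>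
      residual_of_dense_open (isOpen_iUnion fun q => isOpen_ball) ?_
    refine (Rat.denseRange_cast (𝕜 := ℝ)).mono ?_
    rintro _ ⟨q, rfl⟩
    exact Set.mem_iUnion.2 ⟨q, mem_ball_self (hε0 j q)⟩
  · rw [← hD]
    refine ENNReal.le_of_forall_pos_le_add fun e he _ => ?_
    rw [← ENNReal.coe_add]
    refine dimH_le_of_closedBall_cover (by positivity) fun η hη => ?_
    obtain ⟨j, hj⟩ := exists_nat_one_div_lt (lt_min (lt_min he hη) one_pos)
    have hje : (1 : ℝ≥0) / (j + 1) ≤ e := hj.le.trans ((min_le_left _ _).trans (min_le_left _ _))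
    have hjη : (1 : ℝ≥0) / (j + 1) ≤ η := hj.le.trans ((min_le_left _ _).trans (min_le_right _ _))
    have hj1 : (1 : ℝ≥0) / (j + 1) ≤ 1 := hj.le.trans (min_le_right _ _)
    have htot : ∑' q, (ω j q : ℝ≥0∞) ≤ ((1 / (j + 1) : ℝ≥0) : ℝ≥0∞) := (hωsum j).le
    refine ⟨Σ q : ℚ, F j q, inferInstance, fun a => (x j a.1 a.2, (a.1 : ℝ)), fun a => r j a.1 a.2,
      ?_, ?_⟩
    · rintro ⟨y, z⟩ ⟨hy, hz⟩
      obtain ⟨q, hq⟩ := Set.mem_iUnion.1 (Set.mem_iInter.1 hz j)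
      obtain ⟨i, hi, hyi⟩ := Set.mem_iUnion₂.1 (hcov j q hy)
      refine Set.mem_iUnion.2 ⟨⟨q, i, hi⟩, ?_⟩
      rw [mem_closedBall, Prod.dist_eq]
      exact max_le (mem_ball.1 hyi).le ((mem_ball.1 hq).le.trans (hε j q i hi))
    · have hr1 : ∀ q, ∀ i ∈ F j q, r j q i ≤ 1 := fun q i hi => by
        have h1 : (r j q i : ℝ≥0∞) ^ (σ j : ℝ) ≤ 1 :=
          (Finset.single_le_sum (f := fun i => (r j q i : ℝ≥0∞) ^ (σ j : ℝ))
            (fun _ _ => bot_le) hi).trans ((hsum j q).le.trans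
            ((ENNReal.le_tsum q).trans (htot.trans (by exact_mod_cast hj1))))
        by_contra! h
        exact h1.not_gt (ENNReal.one_lt_rpow (by exact_mod_cast h) (by exact_mod_cast hσ0 j))
      calc ∑' a : Σ q : ℚ, F j q, (r j a.1 a.2 : ℝ≥0∞) ^ ((D + e : ℝ≥0) : ℝ)
          ≤ ∑' a : Σ q : ℚ, F j q, (r j a.1 a.2 : ℝ≥0∞) ^ (σ j : ℝ) :=
            ENNReal.tsum_le_tsum fun a => ENNReal.rpow_le_rpow_of_exponent_ge
              (by exact_mod_cast hr1 a.1 a.2 a.2.2)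
              (NNReal.coe_le_coe.2 (add_le_add_right hje D))
        _ = ∑' q, ∑ i ∈ F j q, (r j q i : ℝ≥0∞) ^ (σ j : ℝ) := by
            rw [ENNReal.tsum_sigma (fun q (i : F j q) => (r j q i : ℝ≥0∞) ^ (σ j : ℝ))]
            exact tsum_congr fun q =>
              (F j q).tsum_subtype (fun i => (r j q i : ℝ≥0∞) ^ (σ j : ℝ))
        _ ≤ ∑' q, (ω j q : ℝ≥0∞) := ENNReal.tsum_le_tsum fun q => (hsum j q).le
        _ ≤ η := htot.trans (by exact_mod_cast hjη)

end ResidualFactor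

/-! ### Discrete models of `s`-dimensional measures. -/

section Grids

open Metric MeasureTheory Filter
open scoped NNReal Topology

theorem card_filter_natCast_div_mem_closedBall_le {B : ℕ} (hB : 0 < B) (y : ℝ) {ρ : ℝ}
    (hρ : 0 ≤ ρ) [DecidablePred fun k : ℕ => (k : ℝ) / B ∈ closedBall y ρ] :
    (((Finset.range B).filter fun k : ℕ => (k : ℝ) / B ∈ closedBall y ρ).card : ℝ)
      ≤ 2 * ρ * B + 1 := by
  have hB' : (0 : ℝ) < B := by exact_mod_cast hB
  have hsub : ((Finset.range B).filter fun k : ℕ => (k : ℝ) / B ∈ closedBall y ρ).card ≤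
      (Finset.Icc ⌈(y - ρ) * B⌉ ⌊(y + ρ) * B⌋).card := by
    refine Finset.card_le_card_of_injOn (fun k => (k : ℤ)) (fun k hk => ?_)
      (fun a _ b _ h => by simpa using h)
    have hk2 := (Finset.mem_filter.1 hk).2
    rw [Real.closedBall_eq_Icc, Set.mem_Icc, le_div_iff₀ hB', div_le_iff₀ hB'] at hk2
    simp only [Finset.coe_Icc, Set.mem_Icc, Int.ceil_le, Int.le_floor]
    exact_mod_cast hk2
  have h1 := Int.floor_le ((y + ρ) * B)
  have h2 := Int.le_ceil ((y - ρ) * B)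
  have h3 := Int.lt_floor_add_one ((y + ρ) * B)
  have h4 := Int.ceil_lt_add_one ((y - ρ) * B)
  have hρB : 0 ≤ ρ * B := by positivity
  rw [Int.card_Icc] at hsub
  have h5 : (0 : ℤ) ≤ ⌊(y + ρ) * B⌋ + 1 - ⌈(y - ρ) * B⌉ := by
    have : (-1 : ℝ) < ((⌊(y + ρ) * B⌋ + 1 - ⌈(y - ρ) * B⌉ : ℤ) : ℝ) := by push_cast; nlinarith
    have : (-1 : ℤ) < ⌊(y + ρ) * B⌋ + 1 - ⌈(y - ρ) * B⌉ := by exact_mod_cast this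
    omega
  have h6 : (((⌊(y + ρ) * B⌋ + 1 - ⌈(y - ρ) * B⌉).toNat : ℤ) : ℝ) =
      ((⌊(y + ρ) * B⌋ + 1 - ⌈(y - ρ) * B⌉ : ℤ) : ℝ) := by rw [Int.toNat_of_nonneg h5]
  push_cast at h6
  have h7 : (((Finset.range B).filter fun k : ℕ => (k : ℝ) / B ∈ closedBall y ρ).card : ℝ) ≤
      ((⌊(y + ρ) * B⌋ + 1 - ⌈(y - ρ) * B⌉).toNat : ℝ) := by exact_mod_cast hsub
  rw [h6] at h7
  nlinarith

/-- The uniform measure on an arithmetic progression in `[0, 1]` with about `ε ^ (-θ)` terms is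
`θ`-dimensional at scales between `ε` and `1`. -/
theorem exists_grid_measure_real {θ ε : ℝ} (hθ0 : 0 ≤ θ) (hθ1 : θ ≤ 1) (hε0 : 0 < ε)
    (hε1 : ε ≤ 1) : ∃ (ν : Measure ℝ) (D : Finset ℝ), IsProbabilityMeasure ν ∧ 0 ∈ D ∧
      (∀ x ∈ D, |x| ≤ 1) ∧ ν D = 1 ∧ (D.card : ℝ) ≤ ε ^ (-θ) ∧
      ∀ y ρ, ε ≤ ρ → ρ ≤ 1 → ν (closedBall y ρ) ≤ ENNReal.ofReal (4 * ρ ^ θ) := by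
  classical
  set B : ℕ := ⌊ε ^ (-θ)⌋₊ with hBdef
  have h1 : 1 ≤ ε ^ (-θ) := Real.one_le_rpow_of_pos_of_le_one_of_nonpos hε0 hε1 (by linarith)
  have hB : 0 < B := Nat.floor_pos.2 h1
  have hB1 : (1 : ℝ) ≤ B := by exact_mod_cast hB
  have hBle : (B : ℝ) ≤ ε ^ (-θ) := Nat.floor_le (by positivity)
  have hBlt : ε ^ (-θ) < B + 1 := Nat.lt_floor_add_one _
  have hB0' : (B : ℝ≥0∞) ≠ 0 := by simpa using hB.ne'
  let ν : Measure ℝ := ∑ k ∈ Finset.range B, (B : ℝ≥0∞)⁻¹ • Measure.dirac ((k : ℝ) / B)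
  have hν : ∀ s : Set ℝ, MeasurableSet s →
      ν s = (B : ℝ≥0∞)⁻¹ * (((Finset.range B).filter fun k : ℕ => (k : ℝ) / B ∈ s).card : ℝ≥0∞) := by
    intro s hs
    simp only [ν, Measure.finsetSum_apply, Measure.smul_apply, smul_eq_mul,
      Measure.dirac_apply' _ hs, ← Finset.mul_sum]
    congr 1
    simp [Set.indicator_apply]
  have hνone : ∀ s : Set ℝ, MeasurableSet s → (∀ k < B, (k : ℝ) / B ∈ s) → ν s = 1 := by
    intro s hs h
    rw [hν s hs, Finset.filter_true_of_mem (fun k hk => h k (Finset.mem_range.1 hk)),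
      Finset.card_range, ENNReal.inv_mul_cancel hB0' (ENNReal.natCast_ne_top _)]
  refine ⟨ν, (Finset.range B).image fun k : ℕ => (k : ℝ) / B,
    ⟨hνone _ MeasurableSet.univ fun _ _ => trivial⟩, ?_, ?_, ?_, ?_, ?_⟩
  · exact Finset.mem_image.2 ⟨0, Finset.mem_range.2 hB, by simp⟩
  · intro x hx
    obtain ⟨k, hk, rfl⟩ := Finset.mem_image.1 hx
    have hk' : (k : ℝ) ≤ B := by exact_mod_cast (Finset.mem_range.1 hk).le
    rw [abs_of_nonneg (by positivity)]
    exact div_le_one_of_le₀ hk' (by positivity)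
  · refine hνone _ (Finset.measurableSet _) fun k hk => ?_
    exact Finset.mem_coe.2 (Finset.mem_image_of_mem _ (Finset.mem_range.2 hk))
  · refine le_trans ?_ hBle
    exact_mod_cast Finset.card_image_le.trans (Finset.card_range B).le
  · intro y ρ hερ hρ1
    have hρ0 : 0 < ρ := hε0.trans_le hερ
    rw [hν _ isClosed_closedBall.measurableSet, mul_comm, ← div_eq_mul_inv]
    refine ENNReal.div_le_of_le_mul ?_
    rw [← ENNReal.ofReal_natCast B, ← ENNReal.ofReal_mul (by positivity),
      ← ENNReal.ofReal_natCast]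
    refine ENNReal.ofReal_le_ofReal ?_
    refine (card_filter_natCast_div_mem_closedBall_le hB y hρ0.le).trans ?_
    have h2 : ρ ≤ ρ ^ θ := by
      simpa using Real.rpow_le_rpow_of_exponent_ge hρ0 hρ1 hθ1
    have h3 : ε ^ θ ≤ ρ ^ θ := Real.rpow_le_rpow hε0.le hερ hθ0
    have h4 : ε ^ θ * ε ^ (-θ) = 1 := by rw [← Real.rpow_add hε0]; simp
    have h5 : 0 < ε ^ θ := by positivity
    -- This absorbs the `+ 1` in the point count: `B ≥ ε ^ (-θ) / 2` and `ρ ≥ ε`.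
    have h6 : 1 ≤ 2 * (ρ ^ θ * B) := by nlinarith
    nlinarith

/-- Finitely supported measures that are `s`-dimensional at scales between `ε` and `1`. -/
theorem exists_grid_measure {F : Type*} [NormedAddCommGroup F] [InnerProductSpace ℝ F]
    [FiniteDimensional ℝ F] [MeasurableSpace F] [BorelSpace F] {s ε : ℝ} (hs0 : 0 ≤ s)
    (hs1 : s ≤ Module.finrank ℝ F) (hε0 : 0 < ε) (hε1 : ε ≤ 1) :
    ∃ (ν : Measure F) (D : Finset F), IsProbabilityMeasure ν ∧ 0 ∈ D ∧
      (∀ x ∈ D, ‖x‖ ≤ Module.finrank ℝ F) ∧ ν D = 1 ∧ (D.card : ℝ) ≤ ε ^ (-s) ∧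
      ∀ y ρ, ε ≤ ρ → ρ ≤ 1 →
        ν (closedBall y ρ) ≤ ENNReal.ofReal (4 ^ Module.finrank ℝ F * ρ ^ s) := by
  classical
  set q := Module.finrank ℝ F with hq
  -- The exponent is shared equally among the `q` coordinates; for `q = 0` it must vanish.
  obtain ⟨θ, hθ0, hθ1, hθs⟩ : ∃ θ : ℝ, 0 ≤ θ ∧ θ ≤ 1 ∧ θ * q = s := by
    rcases Nat.eq_zero_or_pos q with h | h
    · rw [h, Nat.cast_zero] at hs1
      exact ⟨0, le_rfl, zero_le_one, by linarith⟩
    · have h' : (0 : ℝ) < q := by exact_mod_cast h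
      exact ⟨s / q, by positivity, (div_le_one h').2 hs1, div_mul_cancel₀ _ h'.ne'⟩
  have hpow : ∀ a : ℝ, 0 ≤ a → (a ^ θ) ^ q = a ^ s := fun a ha => by
    rw [← hθs, Real.rpow_mul ha, Real.rpow_natCast]
  obtain ⟨ν, D, hν, h0, hD1, hνD, hcard, hball⟩ := exists_grid_measure_real hθ0 hθ1 hε0 hε1
  let b : OrthonormalBasis (Fin q) ℝ F := stdOrthonormalBasis ℝ F
  let L : (Fin q → ℝ) → F := fun c => ∑ i, c i • b i
  have hLc : Continuous L := by fun_prop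
  have hLm : Measurable L := hLc.measurable
  have hLi : ∀ c i, inner ℝ (b i) (L c) = c i := fun c i => by
    simp only [L, b.orthonormal.inner_right_fintype]
  have hpi : IsProbabilityMeasure (Measure.pi fun _ : Fin q => ν) := inferInstance
  refine ⟨(Measure.pi fun _ : Fin q => ν).map L, (Fintype.piFinset fun _ => D).image L,
    Measure.isProbabilityMeasure_map hLm.aemeasurable, ?_, ?_, ?_, ?_, ?_⟩
  · exact Finset.mem_image.2 ⟨0, Fintype.mem_piFinset.2 fun _ => h0, by simp [L]⟩
  · intro x hx
    obtain ⟨c, hc, rfl⟩ := Finset.mem_image.1 hx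
    rw [Fintype.mem_piFinset] at hc
    calc ‖L c‖ ≤ ∑ i, ‖c i • b i‖ := norm_sum_le _ _
      _ ≤ ∑ i : Fin q, (1 : ℝ) := Finset.sum_le_sum fun i _ => by
          rw [norm_smul, b.norm_eq_one, mul_one]
          exact hD1 _ (hc i)
      _ = q := by simp
  · have := Measure.isProbabilityMeasure_map (μ := Measure.pi fun _ : Fin q => ν) hLm.aemeasurable
    refine le_antisymm prob_le_one ?_
    rw [Measure.map_apply hLm (Finset.measurableSet _)]
    calc (1 : ℝ≥0∞) = (Measure.pi fun _ : Fin q => ν) (Set.univ.pi fun _ => (D : Set ℝ)) := by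
          rw [Measure.pi_pi]; simp [hνD]
      _ ≤ _ := measure_mono fun c hc => by
          refine Finset.mem_coe.2 (Finset.mem_image_of_mem _ (Fintype.mem_piFinset.2 fun i => ?_))
          exact hc i trivial
  · calc (((Fintype.piFinset fun _ : Fin q => D).image L).card : ℝ)
        ≤ (D.card : ℝ) ^ q := by
          have := (Finset.card_image_le (s := Fintype.piFinset fun _ : Fin q => D) (f := L))
          rw [Fintype.card_piFinset_const] at this
          exact_mod_cast this
      _ ≤ (ε ^ (-θ)) ^ q := by gcongr
      _ = ε ^ (-s) := by
          rw [Real.rpow_neg hε0.le, Real.rpow_neg hε0.le, inv_pow, hpow _ hε0.le]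
  · intro y ρ hερ hρ1
    rw [Measure.map_apply hLm isClosed_closedBall.measurableSet]
    calc (Measure.pi fun _ : Fin q => ν) (L ⁻¹' closedBall y ρ)
        ≤ (Measure.pi fun _ : Fin q => ν) (Set.univ.pi fun i => closedBall (inner ℝ (b i) y) ρ) := by
          refine measure_mono fun c hc i _ => ?_
          rw [mem_closedBall, Real.dist_eq, ← hLi c i, ← inner_sub_right]
          refine (abs_real_inner_le_norm _ _).trans ?_
          rw [b.norm_eq_one, one_mul, ← dist_eq_norm]
          exact hc
      _ = ∏ i : Fin q, ν (closedBall (inner ℝ (b i) y) ρ) := Measure.pi_pi _ _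
      _ ≤ ∏ i : Fin q, ENNReal.ofReal (4 * ρ ^ θ) :=
          Finset.prod_le_prod' fun i _ => hball _ _ hερ hρ1
      _ = ENNReal.ofReal (4 ^ q * ρ ^ s) := by
          have hρ0 : 0 < ρ := hε0.trans_le hερ
          rw [Finset.prod_const, Finset.card_univ, Fintype.card_fin,
            ← ENNReal.ofReal_pow (by positivity), mul_pow, hpow _ hρ0.le]

end Grids

/-! ### Grids adapted to a subspace. -/

section AdaptedGrids

open Metric MeasureTheory Filter
open scoped NNReal Topology

/-- Finitely supported measures that are `d`-dimensional at scales between `ε` and `1`, and whose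
projection to `W` has as few points as possible. -/
theorem exists_adapted_grid_measure {F : Type*} [NormedAddCommGroup F] [InnerProductSpace ℝ F]
    [FiniteDimensional ℝ F] [MeasurableSpace F] [BorelSpace F] (W : Submodule ℝ F) {d ε : ℝ}
    (hd0 : 0 ≤ d) (hd1 : d ≤ Module.finrank ℝ F) (hε0 : 0 < ε) (hε1 : ε ≤ 1) :
    ∃ (ν : Measure F) (T : Set F), T.Finite ∧ IsProbabilityMeasure ν ∧ 0 ∈ T ∧
      (∀ x ∈ T, ‖x‖ ≤ Module.finrank ℝ F) ∧ ν T = 1 ∧ (T.ncard : ℝ) ≤ ε ^ (-d) ∧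
      ((W.orthogonalProjectionOnto '' T).ncard : ℝ) ≤ ε ^ (-max 0 (d - Module.finrank ℝ Wᗮ)) ∧
      ∀ y ρ, ε ≤ ρ → ρ ≤ 1 →
        ν (closedBall y ρ) ≤ ENNReal.ofReal (4 ^ Module.finrank ℝ F * ρ ^ d) := by
  have hsum : Module.finrank ℝ W + Module.finrank ℝ Wᗮ = Module.finrank ℝ F :=
    W.finrank_add_finrank_orthogonal
  have hsum' : (Module.finrank ℝ W : ℝ) + Module.finrank ℝ Wᗮ = Module.finrank ℝ F := by
    exact_mod_cast hsum
  -- `Wᗮ` carries as much of the dimension as it can, `d - e = min d (dim Wᗮ)`, and only the excess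
  -- `e` is put into `W`.
  set e : ℝ := max 0 (d - Module.finrank ℝ Wᗮ) with he
  have he0 : 0 ≤ e := le_max_left _ _
  have he1 : e ≤ Module.finrank ℝ W := max_le (by positivity) (by linarith)
  have hu0 : 0 ≤ d - e := by
    have : e ≤ d := max_le hd0 (sub_le_self _ (by positivity))
    linarith
  have hu1 : d - e ≤ Module.finrank ℝ Wᗮ := by
    have : d - Module.finrank ℝ Wᗮ ≤ e := le_max_right _ _
    linarith
  obtain ⟨ν₁, D₁, hν₁, h01, hn1, hD1, hc1, hb1⟩ := exists_grid_measure (F := W) he0 he1 hε0 hε1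
  obtain ⟨ν₂, D₂, hν₂, h02, hn2, hD2, hc2, hb2⟩ := exists_grid_measure (F := Wᗮ) hu0 hu1 hε0 hε1
  let L : W × Wᗮ → F := fun a => (a.1 : F) + (a.2 : F)
  have hLm : Measurable L := by fun_prop
  have hL1 : ∀ a, W.orthogonalProjectionOnto (L a) = a.1 := fun a => by
    simp only [L, map_add, Submodule.orthogonalProjectionOnto_mem_subspace_eq_self]
    rw [Submodule.orthogonalProjectionOnto_apply_of_mem_orthogonal a.2.2, add_zero]
  have hL2 : ∀ a, Wᗮ.orthogonalProjectionOnto (L a) = a.2 := fun a => by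
    simp only [L, map_add, Submodule.orthogonalProjectionOnto_mem_subspace_eq_self]
    rw [Submodule.orthogonalProjectionOnto_orthogonal_apply_eq_zero a.1.2, zero_add]
  have hprob := Measure.isProbabilityMeasure_map (μ := ν₁.prod ν₂) hLm.aemeasurable
  have hfin : (L '' ((D₁ : Set W) ×ˢ (D₂ : Set Wᗮ))).Finite :=
    (D₁.finite_toSet.prod D₂.finite_toSet).image L
  refine ⟨(ν₁.prod ν₂).map L, L '' ((D₁ : Set W) ×ˢ (D₂ : Set Wᗮ)), hfin, hprob, ?_, ?_, ?_, ?_,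
    ?_, ?_⟩
  · exact ⟨0, ⟨h01, h02⟩, by simp [L]⟩
  · rintro _ ⟨a, ⟨ha1, ha2⟩, rfl⟩
    rw [← hsum']
    exact (norm_add_le _ _).trans (add_le_add (hn1 _ ha1) (hn2 _ ha2))
  · refine le_antisymm prob_le_one ?_
    rw [Measure.map_apply hLm hfin.measurableSet]
    calc (1 : ℝ≥0∞) = (ν₁.prod ν₂) ((D₁ : Set W) ×ˢ (D₂ : Set Wᗮ)) := by
          rw [Measure.prod_prod, hD1, hD2, one_mul]
      _ ≤ _ := measure_mono (Set.subset_preimage_image _ _)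
  · calc ((L '' ((D₁ : Set W) ×ˢ (D₂ : Set Wᗮ))).ncard : ℝ)
        ≤ (D₁.card : ℝ) * D₂.card := by
          have h := Set.ncard_image_le (f := L) (D₁.finite_toSet.prod D₂.finite_toSet)
          rw [Set.ncard_prod, Set.ncard_coe_finset, Set.ncard_coe_finset] at h
          exact_mod_cast h
      _ ≤ ε ^ (-e) * ε ^ (-(d - e)) := by gcongr
      _ = ε ^ (-d) := by rw [← Real.rpow_add hε0]; congr 1; ring
  · refine le_trans ?_ hc1
    have hsub : W.orthogonalProjectionOnto '' (L '' ((D₁ : Set W) ×ˢ (D₂ : Set Wᗮ))) ⊆ D₁ := by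
      rintro _ ⟨_, ⟨a, ha, rfl⟩, rfl⟩
      rw [hL1]
      exact ha.1
    have h := Set.ncard_le_ncard hsub D₁.finite_toSet
    rw [Set.ncard_coe_finset] at h
    exact_mod_cast h
  · intro y ρ hερ hρ1
    have hρ0 : 0 < ρ := hε0.trans_le hερ
    rw [Measure.map_apply hLm isClosed_closedBall.measurableSet]
    calc (ν₁.prod ν₂) (L ⁻¹' closedBall y ρ)
        ≤ (ν₁.prod ν₂) (closedBall (W.orthogonalProjectionOnto y) ρ ×ˢ
            closedBall (Wᗮ.orthogonalProjectionOnto y) ρ) := by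
          refine measure_mono fun a ha => ⟨?_, ?_⟩
          · rw [← hL1 a]
            exact (W.lipschitzWith_orthogonalProjectionOnto.dist_le_mul _ _).trans
              (by simpa using ha)
          · rw [← hL2 a]
            exact (Wᗮ.lipschitzWith_orthogonalProjectionOnto.dist_le_mul _ _).trans
              (by simpa using ha)
      _ ≤ ENNReal.ofReal (4 ^ Module.finrank ℝ W * ρ ^ e) *
            ENNReal.ofReal (4 ^ Module.finrank ℝ Wᗮ * ρ ^ (d - e)) := by
          rw [Measure.prod_prod]
          exact mul_le_mul' (hb1 _ _ hερ hρ1) (hb2 _ _ hερ hρ1)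
      _ = _ := by
          rw [← ENNReal.ofReal_mul (by positivity), ← hsum, pow_add]
          congr 1
          have : ρ ^ d = ρ ^ e * ρ ^ (d - e) := by rw [← Real.rpow_add hρ0]; congr 1; ring
          rw [this]; ring

end AdaptedGrids

/-! ### Rapidly decreasing scales. -/

section Scales

open Filter
open scoped Topology

/-- A rapidly decreasing sequence of scales. -/
noncomputable def cantorScale (N : ℕ) : ℕ → ℝ
  | 0 => 1
  | j + 1 => cantorScale N j * (cantorScale N j / 2) ^ (N * (j + 1))

/-- The ratio of consecutive scales. -/
noncomputable def cantorRatio (N j : ℕ) : ℝ := (cantorScale N j / 2) ^ (N * (j + 1))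

theorem cantorScale_succ (N j : ℕ) :
    cantorScale N (j + 1) = cantorScale N j * cantorRatio N j := rfl

theorem cantorScale_pos (N j : ℕ) : 0 < cantorScale N j := by
  induction j with
  | zero => exact one_pos
  | succ j ih => exact mul_pos ih (by positivity)

theorem cantorRatio_pos (N j : ℕ) : 0 < cantorRatio N j :=
  pow_pos (half_pos (cantorScale_pos N j)) _

variable {N : ℕ}

theorem cantorScale_le_one (N j : ℕ) : cantorScale N j ≤ 1 := by
  induction j with
  | zero => exact le_rfl
  | succ j ih =>
    have := cantorScale_pos N j
    exact mul_le_one₀ ih (by positivity) (pow_le_one₀ (by positivity) (by linarith))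

theorem cantorRatio_le (hN : 0 < N) (j : ℕ) : cantorRatio N j ≤ (1 / 2) ^ (j + 1) := by
  have h0 := cantorScale_pos N j
  have h1 := cantorScale_le_one N j
  calc cantorRatio N j ≤ (1 / 2) ^ (N * (j + 1)) := by
        refine pow_le_pow_left₀ (by positivity) (by linarith) _
    _ ≤ (1 / 2) ^ (j + 1) :=
        pow_le_pow_of_le_one (by norm_num) (by norm_num) (Nat.le_mul_of_pos_left _ hN)

theorem cantorRatio_le_half (hN : 0 < N) (j : ℕ) : cantorRatio N j ≤ 1 / 2 :=
  (cantorRatio_le hN j).trans (pow_le_of_le_one (by norm_num) (by norm_num) (by omega))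

theorem cantorScale_le_pow (hN : 0 < N) (j : ℕ) : cantorScale N j ≤ (1 / 2) ^ j := by
  induction j with
  | zero => exact le_rfl
  | succ j ih =>
    rw [cantorScale_succ, pow_succ]
    exact mul_le_mul ih (cantorRatio_le_half hN j) (cantorRatio_pos N j).le (by positivity)

theorem tendsto_cantorScale (hN : 0 < N) : Tendsto (cantorScale N) atTop (𝓝 0) :=
  squeeze_zero (fun j => (cantorScale_pos N j).le) (cantorScale_le_pow hN)
    (tendsto_pow_atTop_nhds_zero_of_lt_one (by norm_num) (by norm_num))

/-- The ratios tend to zero, so eventually each step multiplies the left side by at most `1`. This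
absorbs constants that grow by a fixed factor per digit. -/
theorem exists_forall_pow_mul_cantorScale_rpow_le (hN : 0 < N) {D σ : ℝ} (hD : 0 ≤ D)
    (hσ : 0 < σ) : ∃ c, ∀ j, D ^ (j + 1) * cantorScale N j ^ σ ≤ c := by
  have hlim : Tendsto (fun j : ℕ => D * ((1 / 2 : ℝ) ^ (j + 1)) ^ σ) atTop (𝓝 0) := by
    have h1 : Tendsto (fun j : ℕ => ((1 / 2 : ℝ) ^ (j + 1))) atTop (𝓝 0) :=
      (tendsto_pow_atTop_nhds_zero_of_lt_one (by norm_num) (by norm_num)).comp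
        (tendsto_add_atTop_nat 1)
    have h2 := (h1.rpow_const (p := σ) (Or.inr hσ.le)).const_mul D
    rwa [Real.zero_rpow hσ.ne', mul_zero] at h2
  obtain ⟨j0, hj0⟩ := eventually_atTop.1 (hlim.eventually_le_const one_pos)
  have ha0 : ∀ j, 0 ≤ D ^ (j + 1) * cantorScale N j ^ σ := fun j => by
    have := cantorScale_pos N j
    positivity
  refine ⟨∑ i ∈ Finset.range (j0 + 1), D ^ (i + 1) * cantorScale N i ^ σ, fun j => ?_⟩
  have hsmall : ∀ j ≤ j0, D ^ (j + 1) * cantorScale N j ^ σ ≤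
      ∑ i ∈ Finset.range (j0 + 1), D ^ (i + 1) * cantorScale N i ^ σ := fun j hj =>
    Finset.single_le_sum (f := fun i => D ^ (i + 1) * cantorScale N i ^ σ) (fun i _ => ha0 i)
      (Finset.mem_range.2 (by omega))
  rcases le_total j j0 with h | h
  · exact hsmall j h
  induction j, h using Nat.le_induction with
  | base => exact hsmall j0 le_rfl
  | succ j hj ih =>
    refine le_trans ?_ ih
    rw [cantorScale_succ, Real.mul_rpow (cantorScale_pos N j).le (cantorRatio_pos N j).le,
      pow_succ D (j + 1)]
    have h1 : D * cantorRatio N j ^ σ ≤ 1 := by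
      refine le_trans ?_ (hj0 j hj)
      exact mul_le_mul_of_nonneg_left
        (Real.rpow_le_rpow (cantorRatio_pos N j).le (cantorRatio_le hN j) hσ.le) hD
    calc D ^ (j + 1) * D * (cantorScale N j ^ σ * cantorRatio N j ^ σ)
        = D ^ (j + 1) * cantorScale N j ^ σ * (D * cantorRatio N j ^ σ) := by ring
      _ ≤ _ := mul_le_of_le_one_right (ha0 j) h1

/-- The growing exponent in the ratio gives `ε_j ^ σ ≤ δ_j ^ (n + 1)` once `j ≥ 1 / σ`. Hence the
`δ_j ^ (-d)` choices of the earlier digits are negligible at the next scale. -/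
theorem eventually_cantorScale_rpow_mul_cantorRatio_rpow_le {n : ℕ} {d σ : ℝ} (hd : d ≤ n)
    (hσ : 0 < σ) : ∀ᶠ j in atTop,
      cantorScale (n + 1) j ^ (-d) * cantorRatio (n + 1) j ^ σ ≤ cantorScale (n + 1) j := by
  obtain ⟨j0, hj0⟩ := exists_nat_ge (1 / σ)
  refine eventually_atTop.2 ⟨j0, fun j hj => ?_⟩
  set δ := cantorScale (n + 1) j with hδ
  have h0 : 0 < δ := cantorScale_pos _ j
  have h1 : δ ≤ 1 := cantorScale_le_one _ j
  have hjσ : 1 ≤ ((j : ℝ) + 1) * σ := by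
    rw [div_le_iff₀ hσ] at hj0
    have : (j0 : ℝ) ≤ j := by exact_mod_cast hj
    nlinarith
  have h2 : cantorRatio (n + 1) j ^ σ ≤ δ ^ ((n : ℝ) + 1) := by
    calc cantorRatio (n + 1) j ^ σ ≤ (δ ^ ((n + 1) * (j + 1))) ^ σ := by
          refine Real.rpow_le_rpow (cantorRatio_pos _ j).le ?_ hσ.le
          exact pow_le_pow_left₀ (by positivity) (by linarith) _
      _ = δ ^ (((n : ℝ) + 1) * (((j : ℝ) + 1) * σ)) := by
          rw [← Real.rpow_natCast, ← Real.rpow_mul h0.le]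
          push_cast
          ring_nf
      _ ≤ δ ^ ((n : ℝ) + 1) :=
          Real.rpow_le_rpow_of_exponent_ge h0 h1 (le_mul_of_one_le_right (by positivity) hjσ)
  calc δ ^ (-d) * cantorRatio (n + 1) j ^ σ ≤ δ ^ (-(n : ℝ)) * δ ^ ((n : ℝ) + 1) :=
        mul_le_mul (Real.rpow_le_rpow_of_exponent_ge h0 h1 (by linarith)) h2
          (Real.rpow_nonneg (cantorRatio_pos _ j).le _) (by positivity)
    _ = δ := by rw [← Real.rpow_add h0]; simp

end Scales

/-! ### Cantor-type digit sets and upper bounds for their projections. -/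

section CantorSets

open Metric MeasureTheory Filter
open scoped NNReal Topology

variable {F : Type*} [NormedAddCommGroup F] [InnerProductSpace ℝ F]

/-- The finite sums `∑ i < j, δ i • t i` with `t i ∈ T i`. -/
def digitSums (δ : ℕ → ℝ) (T : ℕ → Set F) : ℕ → Set F
  | 0 => {0}
  | j + 1 => (fun a : F × F => a.1 + δ j • a.2) '' (digitSums δ T j ×ˢ T j)

/-- The law of `∑ i < j, δ i • t i` for independent `t i` with laws `ν i`. -/
noncomputable def digitLaw [MeasurableSpace F] (δ : ℕ → ℝ) (ν : ℕ → Measure F) : ℕ → Measure F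
  | 0 => Measure.dirac 0
  | j + 1 => ((digitLaw δ ν j).prod (ν j)).map fun a : F × F => a.1 + δ j • a.2

/-- The compact set of all infinite sums `∑ i, δ i • t i` with `t i ∈ T i`. -/
def digitSet (δ : ℕ → ℝ) (T : ℕ → Set F) : Set F := closure (⋃ j, digitSums δ T j)

variable {δ : ℕ → ℝ} {T : ℕ → Set F} {R : ℝ}

theorem finite_digitSums (hT : ∀ j, (T j).Finite) (j : ℕ) : (digitSums δ T j).Finite := by
  induction j with
  | zero => exact Set.finite_singleton 0
  | succ j ih => exact (ih.prod (hT j)).image _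

theorem digitSums_subset_digitSet (j : ℕ) : digitSums δ T j ⊆ digitSet δ T :=
  (Set.subset_iUnion _ j).trans subset_closure

theorem digitSums_mono (hT0 : ∀ j, 0 ∈ T j) : Monotone (digitSums δ T) :=
  monotone_nat_of_le_succ fun j x hx => ⟨(x, 0), ⟨hx, hT0 j⟩, by simp⟩

/-- The difference form makes the induction telescope: halving scales give `R δ_j ≤ 2 R (δ_j -
δ_{j+1})`. -/
theorem exists_digitSums_dist_le (hR : 0 ≤ R) (hδ0 : ∀ j, 0 < δ j)
    (hδ : ∀ j, δ (j + 1) ≤ δ j / 2) (hTR : ∀ j, ∀ t ∈ T j, ‖t‖ ≤ R) (i k : ℕ) :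
    ∀ x ∈ digitSums δ T (i + k), ∃ y ∈ digitSums δ T i,
      dist x y ≤ 2 * R * (δ i - δ (i + k)) := by
  induction k with
  | zero => exact fun x hx => ⟨x, hx, by simp⟩
  | succ k ih =>
    rintro _ ⟨⟨x, t⟩, ⟨hx, ht⟩, rfl⟩
    obtain ⟨y, hy, hxy⟩ := ih x hx
    refine ⟨y, hy, ?_⟩
    have h1 : dist (x + δ (i + k) • t) x ≤ R * δ (i + k) := by
      rw [dist_eq_norm, add_sub_cancel_left, norm_smul, Real.norm_of_nonneg (hδ0 _).le, mul_comm]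
      exact mul_le_mul_of_nonneg_right (hTR _ t ht) (hδ0 _).le
    have h2 := dist_triangle (x + δ (i + k) • t) x y
    have h3 := mul_le_mul_of_nonneg_left (hδ (i + k)) hR
    change dist (x + δ (i + k) • t) y ≤ 2 * R * (δ i - δ (i + k + 1))
    linarith

theorem digitSet_subset_iUnion_closedBall (hR : 0 ≤ R) (hδ0 : ∀ j, 0 < δ j)
    (hδ : ∀ j, δ (j + 1) ≤ δ j / 2) (hT : ∀ j, (T j).Finite) (hT0 : ∀ j, 0 ∈ T j)
    (hTR : ∀ j, ∀ t ∈ T j, ‖t‖ ≤ R) (i : ℕ) :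
    digitSet δ T ⊆ ⋃ y ∈ digitSums δ T i, closedBall y (2 * R * δ i) := by
  refine closure_minimal (Set.iUnion_subset fun j x hx => ?_)
    ((finite_digitSums hT i).isClosed_biUnion fun _ _ => isClosed_closedBall)
  obtain ⟨y, hy, hxy⟩ := exists_digitSums_dist_le hR hδ0 hδ hTR i j x
    (digitSums_mono hT0 (Nat.le_add_left j i) hx)
  refine Set.mem_iUnion₂.2 ⟨y, hy, mem_closedBall.2 (hxy.trans ?_)⟩
  exact mul_le_mul_of_nonneg_left (sub_le_self _ (hδ0 _).le) (by positivity)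

theorem isCompact_digitSet [FiniteDimensional ℝ F] (hR : 0 ≤ R) (hδ0 : ∀ j, 0 < δ j)
    (hδ : ∀ j, δ (j + 1) ≤ δ j / 2) (hT : ∀ j, (T j).Finite) (hT0 : ∀ j, 0 ∈ T j)
    (hTR : ∀ j, ∀ t ∈ T j, ‖t‖ ≤ R) : IsCompact (digitSet δ T) :=
  isCompact_of_isClosed_isBounded isClosed_closure
    (((Bornology.isBounded_biUnion (finite_digitSums hT 0)).2 fun _ _ =>
      isBounded_closedBall).subset (digitSet_subset_iUnion_closedBall hR hδ0 hδ hT hT0 hTR 0))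

theorem ncard_digitSums_le {ε : ℕ → ℝ} {d : ℝ} (hδ1 : δ 0 = 1)
    (hδε : ∀ j, δ (j + 1) = δ j * ε j) (hδ0 : ∀ j, 0 < δ j) (hε0 : ∀ j, 0 < ε j)
    (hT : ∀ j, (T j).Finite) (hTd : ∀ j, ((T j).ncard : ℝ) ≤ ε j ^ (-d)) (j : ℕ) :
    ((digitSums δ T j).ncard : ℝ) ≤ δ j ^ (-d) := by
  induction j with
  | zero => simp [digitSums, hδ1]
  | succ j ih =>
    have h := Set.ncard_image_le (f := fun a : F × F => a.1 + δ j • a.2)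
      ((finite_digitSums (δ := δ) hT j).prod (hT j))
    rw [Set.ncard_prod] at h
    calc ((digitSums δ T (j + 1)).ncard : ℝ)
        ≤ (digitSums δ T j).ncard * (T j).ncard := by exact_mod_cast h
      _ ≤ δ j ^ (-d) * ε j ^ (-d) :=
          mul_le_mul ih (hTd j) (by positivity) (Real.rpow_nonneg (hδ0 j).le _)
      _ = δ (j + 1) ^ (-d) := by rw [hδε, Real.mul_rpow (hδ0 j).le (hε0 j).le]

/-- The projection of a digit set has small dimension if infinitely many digit sets have
small projections. -/
theorem dimH_image_digitSet_le {Y : Type*} [NormedAddCommGroup Y] [NormedSpace ℝ Y]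
    {P : F →L[ℝ] Y} (hP : LipschitzWith 1 P) {ε : ℕ → ℝ} {d e : ℝ} (he : 0 ≤ e) (hR : 0 ≤ R)
    (hδ1 : δ 0 = 1) (hδε : ∀ j, δ (j + 1) = δ j * ε j) (hδ0 : ∀ j, 0 < δ j)
    (hε0 : ∀ j, 0 < ε j) (hε1 : ∀ j, ε j ≤ 1 / 2) (hδlim : Tendsto δ atTop (𝓝 0))
    (hδd : ∀ σ : ℝ, 0 < σ → ∀ᶠ j in atTop, δ j ^ (-d) * ε j ^ σ ≤ δ j)
    (hT : ∀ j, (T j).Finite) (hT0 : ∀ j, 0 ∈ T j) (hTR : ∀ j, ∀ t ∈ T j, ‖t‖ ≤ R)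
    (hTd : ∀ j, ((T j).ncard : ℝ) ≤ ε j ^ (-d))
    (hTe : ∃ᶠ j in atTop, ((P '' T j).ncard : ℝ) ≤ ε j ^ (-e)) :
    dimH (P '' digitSet δ T) ≤ ENNReal.ofReal e := by
  lift e to ℝ≥0 using he
  have hδhalf : ∀ j, δ (j + 1) ≤ δ j / 2 := fun j => by
    have := mul_le_mul_of_nonneg_left (hε1 j) (hδ0 j).le
    rw [hδε]
    linarith
  have hδle : ∀ j, δ j ≤ 1 := fun j => by
    induction j with
    | zero => exact hδ1.le
    | succ j ih => linarith [hδhalf j, hδ0 j]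
  rw [ENNReal.ofReal_coe_nnreal]
  refine ENNReal.le_of_forall_pos_le_add fun σ hσ _ => ?_
  rw [← ENNReal.coe_add]
  have hs : 0 < e + σ := by positivity
  have hs' : (0 : ℝ) < ((e + σ : ℝ≥0) : ℝ) := hs
  refine dimH_le_of_closedBall_cover hs fun η hη => ?_
  have hlim : Tendsto (fun j => (2 * R) ^ ((e + σ : ℝ≥0) : ℝ) * δ j) atTop (𝓝 0) := by
    simpa using hδlim.const_mul ((2 * R) ^ ((e + σ : ℝ≥0) : ℝ))
  obtain ⟨j, hje, hjd, hjη⟩ := (hTe.and_eventually ((hδd σ hσ).and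
    (hlim.eventually_le_const (NNReal.coe_pos.2 hη)))).exists
  have hXfin := finite_digitSums (δ := δ) hT (j + 1)
  have hfin : (P '' digitSums δ T (j + 1)).Finite := hXfin.image P
  let r : ℝ≥0 := ⟨2 * R * δ (j + 1), mul_nonneg (by positivity) (hδ0 _).le⟩
  have := hfin.countable.to_subtype
  -- The earlier digits are counted crudely, without projecting; only the last digit uses the small
  -- projection.
  have hcount : ((P '' digitSums δ T (j + 1)).ncard : ℝ) ≤ δ j ^ (-d) * ε j ^ (-(e : ℝ)) := by
    have hsub : P '' digitSums δ T (j + 1) ⊆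
        (fun a : F × Y => P a.1 + δ j • a.2) '' (digitSums δ T j ×ˢ (P '' T j)) := by
      rintro _ ⟨_, ⟨a, ha, rfl⟩, rfl⟩
      exact ⟨(a.1, P a.2), ⟨ha.1, Set.mem_image_of_mem P ha.2⟩, by simp⟩
    have hpf := (finite_digitSums (δ := δ) hT j).prod ((hT j).image P)
    have h := (Set.ncard_le_ncard hsub (hpf.image _)).trans (Set.ncard_image_le hpf)
    rw [Set.ncard_prod] at h
    calc ((P '' digitSums δ T (j + 1)).ncard : ℝ)
        ≤ (digitSums δ T j).ncard * (P '' T j).ncard := by exact_mod_cast h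
      _ ≤ _ := mul_le_mul (ncard_digitSums_le hδ1 hδε hδ0 hε0 hT hTd j) hje (by positivity)
          (Real.rpow_nonneg (hδ0 j).le _)
  -- Reindexing by `Fin m` puts the index type in `Type`, as the covering criterion requires,
  -- whatever the universe of `Y`.
  obtain ⟨m, ⟨g⟩⟩ : ∃ m, Nonempty ((P '' digitSums δ T (j + 1) : Set Y) ≃ Fin m) := by
    have := hfin.to_subtype
    exact ⟨_, ⟨Finite.equivFin _⟩⟩
  have hm : (P '' digitSums δ T (j + 1)).ncard = m := by
    rw [← Nat.card_coe_set_eq, Nat.card_congr g, Nat.card_fin]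
  refine ⟨Fin m, inferInstance, fun i => (g.symm i : Y), fun _ => r, ?_, ?_⟩
  · rintro _ ⟨x, hx, rfl⟩
    obtain ⟨y, hy, hxy⟩ := Set.mem_iUnion₂.1
      (digitSet_subset_iUnion_closedBall hR hδ0 hδhalf hT hT0 hTR (j + 1) hx)
    refine Set.mem_iUnion.2 ⟨g ⟨P y, Set.mem_image_of_mem P hy⟩, ?_⟩
    simp only [Equiv.symm_apply_apply, mem_closedBall]
    refine (hP.dist_le_mul x y).trans ?_
    rw [NNReal.coe_one, one_mul]
    exact hxy
  · rw [tsum_fintype, Finset.sum_const, Finset.card_univ, Fintype.card_fin, nsmul_eq_mul,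
      ← ENNReal.coe_rpow_of_nonneg _ hs'.le, ← ENNReal.coe_natCast, ← ENNReal.coe_mul,
      ENNReal.coe_le_coe, ← NNReal.coe_le_coe]
    push_cast
    rw [← hm]
    have hδj := hδ0 j
    have hεj := hε0 j
    calc ((P '' digitSums δ T (j + 1)).ncard : ℝ) * (2 * R * δ (j + 1)) ^ ((e : ℝ) + σ)
        ≤ (δ j ^ (-d) * ε j ^ (-(e : ℝ))) * ((2 * R) ^ ((e : ℝ) + σ) * (1 * ε j ^ ((e : ℝ) + σ))) := by
          refine mul_le_mul hcount ?_ (by have := hδ0 (j + 1); positivity) (by positivity)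
          rw [hδε, Real.mul_rpow (by positivity) (by positivity), Real.mul_rpow hδj.le hεj.le]
          gcongr
          exact Real.rpow_le_one hδj.le (hδle j) (by positivity)
      _ = (2 * R) ^ ((e : ℝ) + σ) * (δ j ^ (-d) * ε j ^ (σ : ℝ)) := by
          have h1 : ε j ^ (σ : ℝ) = ε j ^ (-(e : ℝ)) * ε j ^ ((e : ℝ) + σ) := by
            rw [← Real.rpow_add hεj]; congr 1; ring
          rw [h1]; ring
      _ ≤ (2 * R) ^ ((e : ℝ) + σ) * δ j := by gcongr
      _ ≤ η := by simpa using hjη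

end CantorSets

/-! ### Laws of the digit sums and the lower bound for the dimension. -/

section DigitLaws

open Metric MeasureTheory Filter
open scoped NNReal Topology

variable {F : Type*} [NormedAddCommGroup F] [InnerProductSpace ℝ F] [FiniteDimensional ℝ F]
  [MeasurableSpace F] [BorelSpace F]

/-- Condition on the first summand: it must lie within `ρ + R δ` of `y`, and then the second is
confined to a ball of radius `ρ / δ`. -/
theorem map_add_smul_closedBall_le {μ ν : Measure F} [IsProbabilityMeasure μ]
    [IsProbabilityMeasure ν] {δ R ρ : ℝ} (hδ : 0 < δ) {T : Set F} (hT : T.Finite)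
    (hTR : ∀ t ∈ T, ‖t‖ ≤ R) (hνT : ν T = 1) {c : ℝ≥0∞}
    (hc : ∀ z, ν (closedBall z (ρ / δ)) ≤ c) (y : F) :
    (μ.prod ν).map (fun a : F × F => a.1 + δ • a.2) (closedBall y ρ) ≤
      c * μ (closedBall y (ρ + R * δ)) := by
  have hm : Measurable fun a : F × F => a.1 + δ • a.2 := by fun_prop
  rw [Measure.map_apply hm isClosed_closedBall.measurableSet,
    Measure.prod_apply (hm isClosed_closedBall.measurableSet)]
  have hTc : ν Tᶜ = 0 := (prob_compl_eq_zero_iff hT.measurableSet).2 hνT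
  calc ∫⁻ x, ν (Prod.mk x ⁻¹' ((fun a : F × F => a.1 + δ • a.2) ⁻¹' closedBall y ρ)) ∂μ
      ≤ ∫⁻ x, (closedBall y (ρ + R * δ)).indicator (fun _ => c) x ∂μ := by
        refine lintegral_mono fun x => ?_
        by_cases hx : x ∈ closedBall y (ρ + R * δ)
        · rw [Set.indicator_of_mem hx]
          refine le_trans (measure_mono fun t ht => ?_) (hc (δ⁻¹ • (y - x)))
          have ht' : dist (x + δ • t) y ≤ ρ := ht
          rw [mem_closedBall, le_div_iff₀ hδ]
          calc dist t (δ⁻¹ • (y - x)) * δ = ‖δ • (t - δ⁻¹ • (y - x))‖ := by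
                rw [norm_smul, Real.norm_of_nonneg hδ.le, dist_eq_norm, mul_comm]
            _ = dist (x + δ • t) y := by
                rw [dist_eq_norm, smul_sub, smul_inv_smul₀ hδ.ne']
                congr 1; abel
            _ ≤ ρ := ht'
        · rw [Set.indicator_of_notMem hx]
          refine le_trans (measure_mono (t := Tᶜ) fun t ht htT => hx ?_) hTc.le
          have ht' : dist (x + δ • t) y ≤ ρ := ht
          have h1 : dist x (x + δ • t) ≤ R * δ := by
            rw [dist_comm, dist_eq_norm, add_sub_cancel_left, norm_smul,
              Real.norm_of_nonneg hδ.le, mul_comm]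
            exact mul_le_mul_of_nonneg_right (hTR t htT) hδ.le
          exact mem_closedBall.2 ((dist_triangle _ (x + δ • t) _).trans (by linarith))
    _ = c * μ (closedBall y (ρ + R * δ)) := by
        rw [lintegral_indicator isClosed_closedBall.measurableSet, lintegral_const,
          Measure.restrict_apply_univ]

variable {δ : ℕ → ℝ} {T : ℕ → Set F} {ν : ℕ → Measure F} {R : ℝ}

instance isProbabilityMeasure_digitLaw [hν : ∀ j, IsProbabilityMeasure (ν j)] (j : ℕ) :
    IsProbabilityMeasure (digitLaw δ ν j) := by
  induction j with
  | zero => exact Measure.dirac.isProbabilityMeasure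
  | succ j ih =>
    exact Measure.isProbabilityMeasure_map (by fun_prop)

theorem digitLaw_digitSums [∀ j, IsProbabilityMeasure (ν j)] (hT : ∀ j, (T j).Finite)
    (hνT : ∀ j, ν j (T j) = 1) (j : ℕ) : digitLaw δ ν j (digitSums δ T j) = 1 := by
  induction j with
  | zero => simp [digitLaw, digitSums]
  | succ j ih =>
    refine le_antisymm prob_le_one ?_
    have hm : Measurable fun a : F × F => a.1 + δ j • a.2 := by fun_prop
    rw [digitLaw, Measure.map_apply hm (finite_digitSums hT (j + 1)).measurableSet]
    calc (1 : ℝ≥0∞) = ((digitLaw δ ν j).prod (ν j)) (digitSums δ T j ×ˢ T j) := by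
          rw [Measure.prod_prod, ih, hνT, one_mul]
      _ ≤ _ := measure_mono (Set.subset_preimage_image _ _)

theorem digitLaw_add_closedBall_le [∀ j, IsProbabilityMeasure (ν j)] (hR : 0 ≤ R)
    (hδ0 : ∀ j, 0 < δ j) (hδ : ∀ j, δ (j + 1) ≤ δ j / 2) (hT : ∀ j, (T j).Finite)
    (hTR : ∀ j, ∀ t ∈ T j, ‖t‖ ≤ R) (hνT : ∀ j, ν j (T j) = 1) (i k : ℕ) (y : F) (ρ : ℝ) :
    digitLaw δ ν (i + k) (closedBall y ρ) ≤
      digitLaw δ ν i (closedBall y (ρ + 2 * R * (δ i - δ (i + k)))) := by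
  induction k generalizing ρ with
  | zero => simp
  | succ k ih =>
    calc digitLaw δ ν (i + (k + 1)) (closedBall y ρ)
        ≤ 1 * digitLaw δ ν (i + k) (closedBall y (ρ + R * δ (i + k))) :=
          map_add_smul_closedBall_le (hδ0 _) (hT _) (hTR _) (hνT _) (fun _ => prob_le_one) y
      _ ≤ digitLaw δ ν i (closedBall y (ρ + R * δ (i + k) + 2 * R * (δ i - δ (i + k)))) := by
          rw [one_mul]; exact ih _
      _ ≤ _ := by
          refine measure_mono (closedBall_subset_closedBall ?_)
          have := mul_le_mul_of_nonneg_left (hδ (i + k)) hR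
          rw [← add_assoc]
          linarith

variable {ε : ℕ → ℝ} {d K : ℝ}

/-- Each digit costs at most the factor `(1 + R) ^ d * K`. If `ρ ≥ δ j`, the new digit is ignored
and the ball enlarged; otherwise its law contributes `K (ρ / δ j) ^ d` and the earlier law is used
at scale `δ j`. -/
theorem digitLaw_closedBall_le [∀ j, IsProbabilityMeasure (ν j)] (hd : 0 ≤ d) (hR : 0 ≤ R)
    (hK : 1 ≤ K) (hδ1 : δ 0 = 1) (hδε : ∀ j, δ (j + 1) = δ j * ε j) (hδ0 : ∀ j, 0 < δ j)
    (hT : ∀ j, (T j).Finite)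
    (hTR : ∀ j, ∀ t ∈ T j, ‖t‖ ≤ R) (hνT : ∀ j, ν j (T j) = 1)
    (hν : ∀ j y ρ, ε j ≤ ρ → ρ ≤ 1 → ν j (closedBall y ρ) ≤ ENNReal.ofReal (K * ρ ^ d))
    (j : ℕ) (y : F) (ρ : ℝ) (hρ : δ j ≤ ρ) :
    digitLaw δ ν j (closedBall y ρ) ≤ ENNReal.ofReal (((1 + R) ^ d * K) ^ j * ρ ^ d) := by
  have hD : 1 ≤ (1 + R) ^ d := Real.one_le_rpow (by linarith) hd
  induction j generalizing y ρ with
  | zero =>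
    rw [hδ1] at hρ
    refine prob_le_one.trans ?_
    rw [ENNReal.one_le_ofReal, pow_zero, one_mul]
    exact Real.one_le_rpow hρ hd
  | succ j ih =>
    have hδj := hδ0 j
    have hρ0 : 0 < ρ := (hδ0 (j + 1)).trans_le hρ
    have hK0 : 0 < K := by linarith
    rcases le_total (δ j) ρ with h | h
    · calc digitLaw δ ν (j + 1) (closedBall y ρ)
          ≤ 1 * digitLaw δ ν j (closedBall y (ρ + R * δ j)) :=
            map_add_smul_closedBall_le hδj (hT _) (hTR _) (hνT _) (fun _ => prob_le_one) y
        _ ≤ digitLaw δ ν j (closedBall y ((1 + R) * ρ)) := by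
            rw [one_mul]
            refine measure_mono (closedBall_subset_closedBall ?_)
            nlinarith
        _ ≤ ENNReal.ofReal (((1 + R) ^ d * K) ^ j * ((1 + R) * ρ) ^ d) :=
            ih _ _ (by nlinarith)
        _ ≤ _ := by
            refine ENNReal.ofReal_le_ofReal ?_
            rw [Real.mul_rpow (by positivity) hρ0.le, pow_succ]
            calc ((1 + R) ^ d * K) ^ j * ((1 + R) ^ d * ρ ^ d)
                = ((1 + R) ^ d * K) ^ j * ((1 + R) ^ d * 1) * ρ ^ d := by ring
              _ ≤ _ := by gcongr
    · calc digitLaw δ ν (j + 1) (closedBall y ρ)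
          ≤ ENNReal.ofReal (K * (ρ / δ j) ^ d) * digitLaw δ ν j (closedBall y (ρ + R * δ j)) :=
            map_add_smul_closedBall_le hδj (hT _) (hTR _) (hνT _) (fun z => hν j z _
              (by rw [le_div_iff₀ hδj, mul_comm, ← hδε]; exact hρ) ((div_le_one hδj).2 h)) y
        _ ≤ ENNReal.ofReal (K * (ρ / δ j) ^ d) *
              ENNReal.ofReal (((1 + R) ^ d * K) ^ j * ((1 + R) * δ j) ^ d) := by
            gcongr
            refine le_trans (measure_mono (closedBall_subset_closedBall ?_))
              (ih y ((1 + R) * δ j) (by nlinarith))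
            linarith
        _ = _ := by
            rw [← ENNReal.ofReal_mul (by positivity), Real.mul_rpow (by positivity) hδj.le,
              Real.div_rpow hρ0.le hδj.le]
            congr 1
            have : δ j ^ d ≠ 0 := by positivity
            field_simp
            ring

/-- The laws of the digit sums are uniformly `s`-dimensional for each `s < d`. -/
theorem exists_digitLaw_closedBall_le [∀ j, IsProbabilityMeasure (ν j)] {s : ℝ} (hs : 0 ≤ s)
    (hsd : s < d) (hR : 0 ≤ R)
    (hK : 1 ≤ K) (hδ1 : δ 0 = 1) (hδε : ∀ j, δ (j + 1) = δ j * ε j) (hδ0 : ∀ j, 0 < δ j)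
    (hε1 : ∀ j, ε j ≤ 1 / 2)
    (hδD : ∀ D σ : ℝ, 0 ≤ D → 0 < σ → ∃ c, ∀ j, D ^ (j + 1) * δ j ^ σ ≤ c)
    (hT : ∀ j, (T j).Finite)
    (hTR : ∀ j, ∀ t ∈ T j, ‖t‖ ≤ R) (hνT : ∀ j, ν j (T j) = 1)
    (hν : ∀ j y ρ, ε j ≤ ρ → ρ ≤ 1 → ν j (closedBall y ρ) ≤ ENNReal.ofReal (K * ρ ^ d)) :
    ∃ c : ℝ, 0 < c ∧ ∀ J y ρ, δ J ≤ ρ →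
      digitLaw δ ν J (closedBall y ρ) ≤ ENNReal.ofReal (c * ρ ^ s) := by
  have hd : 0 ≤ d := hs.trans hsd.le
  have hδhalf : ∀ j, δ (j + 1) ≤ δ j / 2 := fun j => by
    have := mul_le_mul_of_nonneg_left (hε1 j) (hδ0 j).le
    rw [hδε]
    linarith
  obtain ⟨c, hc⟩ := hδD ((1 + R) ^ d * K) (d - s) (by positivity) (sub_pos.2 hsd)
  refine ⟨max 1 (c * (1 + 2 * R) ^ d), by positivity, fun J y ρ hρ => ?_⟩
  have hρ0 : 0 < ρ := (hδ0 J).trans_le hρ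
  rcases le_or_gt 1 ρ with h1 | h1
  · refine prob_le_one.trans ?_
    rw [ENNReal.one_le_ofReal]
    exact one_le_mul_of_one_le_of_one_le (le_max_left _ _) (Real.one_le_rpow h1 hs)
  classical
  have hex : ∃ j, δ j ≤ ρ := ⟨J, hρ⟩
  -- With `δ (j + 1) ≤ ρ < δ j`, digits after the first `j + 1` only enlarge the ball by a factor,
  -- so the constant does not depend on `J`. The growth in `j` is absorbed by `ρ ^ (d - s) ≤ δ j ^
  -- (d - s)`.
  obtain ⟨j, hj⟩ : ∃ j, Nat.find hex = j + 1 := Nat.exists_eq_succ_of_ne_zero fun h0 => by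
    have := Nat.find_spec hex
    rw [h0, hδ1] at this
    linarith
  have hj1 : δ (j + 1) ≤ ρ := hj ▸ Nat.find_spec hex
  have hj2 : ρ < δ j := not_le.1 (Nat.find_min hex (by omega))
  obtain ⟨k, rfl⟩ : ∃ k, J = j + 1 + k :=
    Nat.exists_eq_add_of_le (hj ▸ Nat.find_min' hex hρ)
  calc digitLaw δ ν (j + 1 + k) (closedBall y ρ)
      ≤ digitLaw δ ν (j + 1) (closedBall y (ρ + 2 * R * (δ (j + 1) - δ (j + 1 + k)))) :=
        digitLaw_add_closedBall_le hR hδ0 hδhalf hT hTR hνT _ _ _ _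
    _ ≤ digitLaw δ ν (j + 1) (closedBall y ((1 + 2 * R) * ρ)) := by
        refine measure_mono (closedBall_subset_closedBall ?_)
        have := hδ0 (j + 1 + k)
        have : R * (δ (j + 1) - δ (j + 1 + k)) ≤ R * ρ :=
          mul_le_mul_of_nonneg_left (by linarith) hR
        linarith
    _ ≤ ENNReal.ofReal (((1 + R) ^ d * K) ^ (j + 1) * ((1 + 2 * R) * ρ) ^ d) :=
        digitLaw_closedBall_le hd hR hK hδ1 hδε hδ0 hT hTR hνT hν _ _ _ (by nlinarith)
    _ ≤ _ := by
        refine ENNReal.ofReal_le_ofReal ?_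
        have h2 : ρ ^ d = ρ ^ (d - s) * ρ ^ s := by rw [← Real.rpow_add hρ0]; congr 1; ring
        have h3 : ρ ^ (d - s) ≤ δ j ^ (d - s) :=
          Real.rpow_le_rpow hρ0.le hj2.le (sub_pos.2 hsd).le
        rw [Real.mul_rpow (by positivity) hρ0.le, h2]
        calc ((1 + R) ^ d * K) ^ (j + 1) * ((1 + 2 * R) ^ d * (ρ ^ (d - s) * ρ ^ s))
            = (((1 + R) ^ d * K) ^ (j + 1) * ρ ^ (d - s)) * (1 + 2 * R) ^ d * ρ ^ s := by ring
          _ ≤ (((1 + R) ^ d * K) ^ (j + 1) * δ j ^ (d - s)) * (1 + 2 * R) ^ d * ρ ^ s := by gcongr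
          _ ≤ c * (1 + 2 * R) ^ d * ρ ^ s := by gcongr; exact hc j
          _ ≤ _ := by gcongr; exact le_max_right _ _

/-- This is the mass distribution principle without a limit measure: by compactness a cheap cover
may be taken finite, and the law at a level `J` finer than all its balls already gives a
contradiction. -/
theorem le_dimH_digitSet [∀ j, IsProbabilityMeasure (ν j)] (hR : 0 ≤ R)
    (hK : 1 ≤ K) (hδ1 : δ 0 = 1) (hδε : ∀ j, δ (j + 1) = δ j * ε j) (hδ0 : ∀ j, 0 < δ j)
    (hε1 : ∀ j, ε j ≤ 1 / 2) (hδlim : Tendsto δ atTop (𝓝 0))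
    (hδD : ∀ D σ : ℝ, 0 ≤ D → 0 < σ → ∃ c, ∀ j, D ^ (j + 1) * δ j ^ σ ≤ c)
    (hT : ∀ j, (T j).Finite) (hT0 : ∀ j, 0 ∈ T j)
    (hTR : ∀ j, ∀ t ∈ T j, ‖t‖ ≤ R) (hνT : ∀ j, ν j (T j) = 1)
    (hν : ∀ j y ρ, ε j ≤ ρ → ρ ≤ 1 → ν j (closedBall y ρ) ≤ ENNReal.ofReal (K * ρ ^ d)) :
    ENNReal.ofReal d ≤ dimH (digitSet δ T) := by
  have hδhalf : ∀ j, δ (j + 1) ≤ δ j / 2 := fun j => by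
    have := mul_le_mul_of_nonneg_left (hε1 j) (hδ0 j).le
    rw [hδε]
    linarith
  by_contra! hlt
  obtain ⟨s, hs1, hs2⟩ := ENNReal.lt_iff_exists_nnreal_btwn.1 hlt
  have hs : 0 < s := ENNReal.coe_pos.1 (bot_le.trans_lt hs1)
  have hsd : (s : ℝ) < d := by
    rwa [← ENNReal.ofReal_coe_nnreal, ENNReal.ofReal_lt_ofReal_iff_of_nonneg s.coe_nonneg] at hs2
  obtain ⟨c, hc0, hc⟩ := exists_digitLaw_closedBall_le s.coe_nonneg hsd hR hK hδ1 hδε hδ0 hε1 hδD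
    hT hTR hνT hν
  have hc1 : ENNReal.ofReal c ≠ 0 := by simpa using hc0
  obtain ⟨x, r, I, hr, hcov, hsum⟩ := (isCompact_digitSet hR hδ0 hδhalf hT hT0
    hTR).exists_finset_ball_cover_of_dimH_lt hs hs1 (η := (ENNReal.ofReal c)⁻¹) (by simp)
  obtain ⟨J, hJ⟩ : ∃ J, ∀ i ∈ I, δ J ≤ r i :=
    ((Finset.eventually_all I).2 fun i _ =>
      hδlim.eventually_le_const (NNReal.coe_pos.2 (hr i))).exists
  have hone : (1 : ℝ≥0∞) < 1 := by
    calc (1 : ℝ≥0∞) = digitLaw δ ν J (digitSums δ T J) := (digitLaw_digitSums hT hνT J).symm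
      _ ≤ digitLaw δ ν J (⋃ i ∈ I, closedBall (x i) (r i)) :=
          measure_mono ((digitSums_subset_digitSet J).trans (hcov.trans
            (Set.iUnion₂_mono fun _ _ => ball_subset_closedBall)))
      _ ≤ ∑ i ∈ I, digitLaw δ ν J (closedBall (x i) (r i)) := measure_biUnion_finset_le _ _
      _ ≤ ∑ i ∈ I, ENNReal.ofReal c * (r i : ℝ≥0∞) ^ (s : ℝ) := Finset.sum_le_sum fun i hi => by
          refine (hc J (x i) (r i) (hJ i hi)).trans_eq ?_
          rw [ENNReal.ofReal_mul hc0.le, ← ENNReal.ofReal_rpow_of_pos (NNReal.coe_pos.2 (hr i)),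
            ENNReal.ofReal_coe_nnreal]
      _ = ENNReal.ofReal c * ∑ i ∈ I, (r i : ℝ≥0∞) ^ (s : ℝ) := (Finset.mul_sum _ _ _).symm
      _ < ENNReal.ofReal c * (ENNReal.ofReal c)⁻¹ :=
          (ENNReal.mul_lt_mul_iff_right hc1 ENNReal.ofReal_ne_top).2 hsum
      _ = 1 := ENNReal.mul_inv_cancel hc1 ENNReal.ofReal_ne_top
  exact lt_irrefl _ hone

/-- There is a compact set of dimension `d` whose projections to countably many given subspaces
all have the smallest possible dimension. -/
theorem exists_isCompact_dimH_eq_and_dimH_projection_le {F : Type*} [NormedAddCommGroup F]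
    [InnerProductSpace ℝ F] [FiniteDimensional ℝ F] (W : ℕ → Submodule ℝ F) {d : ℝ} (hd0 : 0 ≤ d)
    (hd1 : d ≤ Module.finrank ℝ F) :
    ∃ C : Set F, C.Nonempty ∧ IsCompact C ∧ dimH C = ENNReal.ofReal d ∧
      ∀ i, dimH ((W i).orthogonalProjectionOnto '' C) ≤
        ENNReal.ofReal (max 0 (d - Module.finrank ℝ (W i)ᗮ)) := by
  borelize F
  set n := Module.finrank ℝ F with hn
  -- Adding the whole space to the list makes the projection bound also yield `dim C ≤ d`.
  obtain ⟨W', hW0, hWs⟩ : ∃ W' : ℕ → Submodule ℝ F, W' 0 = ⊤ ∧ ∀ i, W' (i + 1) = W i :=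
    ⟨fun i => Nat.casesOn i ⊤ W, rfl, fun _ => rfl⟩
  have hN : 0 < n + 1 := n.succ_pos
  set δ := cantorScale (n + 1)
  set ε := cantorRatio (n + 1)
  have hε1 : ∀ j, ε j ≤ 1 / 2 := cantorRatio_le_half hN
  have hδ0 : ∀ j, 0 < δ j := cantorScale_pos _
  have hε0 : ∀ j, 0 < ε j := cantorRatio_pos _
  have hδhalf : ∀ j, δ (j + 1) ≤ δ j / 2 := fun j => by
    have := mul_le_mul_of_nonneg_left (hε1 j) (hδ0 j).le
    rw [show δ (j + 1) = δ j * ε j from rfl]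
    linarith
  have hR : (0 : ℝ) ≤ n := n.cast_nonneg
  -- The first component of `j.unpair` takes every value infinitely often, so each subspace has
  -- infinitely many adapted digits.
  choose ν T hT hprob hT0 hTR hνT hTd hTe hν using fun j : ℕ =>
    exists_adapted_grid_measure (W' j.unpair.1) hd0 hd1 (hε0 j)
      ((hε1 j).trans (by norm_num))
  have hproj : ∀ i : ℕ, dimH ((W' i).orthogonalProjectionOnto '' digitSet δ T) ≤
      ENNReal.ofReal (max 0 (d - Module.finrank ℝ (W' i)ᗮ)) := fun i => by
    refine dimH_image_digitSet_le (W' i).lipschitzWith_orthogonalProjectionOnto (le_max_left _ _)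
      hR rfl (cantorScale_succ _) hδ0 hε0 hε1 (tendsto_cantorScale hN)
      (fun σ hσ => eventually_cantorScale_rpow_mul_cantorRatio_rpow_le hd1 hσ)
      hT hT0 hTR hTd (frequently_atTop.2 fun k => ⟨Nat.pair i k, Nat.right_le_pair i k, ?_⟩)
    have := hTe (Nat.pair i k)
    rwa [Nat.unpair_pair] at this
  refine ⟨digitSet δ T, ⟨0, digitSums_subset_digitSet 0 rfl⟩,
    isCompact_digitSet hR hδ0 hδhalf hT hT0 hTR, le_antisymm ?_ ?_, fun i => hWs i ▸ hproj (i + 1)⟩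
  · have hproj0 := hproj 0
    rw [hW0] at hproj0
    have h := dimH_preimage_linearMap_le (⊤ : Submodule ℝ F).orthogonalProjectionOnto.toLinearMap
      ((⊤ : Submodule ℝ F).orthogonalProjectionOnto '' digitSet δ T)
    have hker : LinearMap.ker (⊤ : Submodule ℝ F).orthogonalProjectionOnto.toLinearMap = ⊥ := by
      rw [Submodule.ker_orthogonalProjectionOnto, Submodule.top_orthogonal_eq_bot]
    rw [hker, finrank_bot, Nat.cast_zero, add_zero] at h
    refine (dimH_mono (Set.subset_preimage_image _ _)).trans (h.trans (hproj0.trans ?_))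
    refine ENNReal.ofReal_le_ofReal (max_le hd0 (sub_le_self _ (by positivity)))
  · refine le_dimH_digitSet (K := 4 ^ n) hR (one_le_pow₀ (by norm_num)) rfl (cantorScale_succ _)
      hδ0 hε1 (tendsto_cantorScale hN) (fun D σ hD hσ =>
        exists_forall_pow_mul_cantorScale_rpow_le hN hD hσ) hT hT0 hTR hνT hν

end DigitLaws

/-! ### Scaled copies: the lower bound and the generic choice of scales. -/

section ScaledCopies

open Metric MeasureTheory Filter
open scoped NNReal Topology

theorem dimH_scaledCopy {n : ℕ} (x : EuclideanSpace ℝ (Fin n)) {r : ℝ} (hr : r ≠ 0)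
    (S : Set (EuclideanSpace ℝ (Fin n))) : dimH (scaledCopy x r S) = dimH S := by
  have h : scaledCopy x r S = (IsometryEquiv.addLeft x) ''
      ((ContinuousLinearEquiv.smulLeft (R₁ := ℝ) (M₁ := EuclideanSpace ℝ (Fin n))
        (Units.mk0 r hr)) '' S) := by
    rw [Set.image_image]; rfl
  rw [h, IsometryEquiv.dimH_image, ContinuousLinearEquiv.dimH_image]

theorem codim_eq_finrank_orthogonal {n : ℕ} (W : Submodule ℝ (EuclideanSpace ℝ (Fin n))) :
    codim W = Module.finrank ℝ Wᗮ := by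
  have h1 := W.finrank_quotient_add_finrank
  have h2 := W.finrank_add_finrank_orthogonal
  unfold codim
  omega

theorem spanPerp_orthogonal {n : ℕ} (V : AffineSubspace ℝ (EuclideanSpace ℝ (Fin n))) :
    (spanPerp V)ᗮ = Submodule.span ℝ (V : Set (EuclideanSpace ℝ (Fin n))) :=
  Submodule.orthogonal_orthogonal _

/-- The set of centres has dimension at most that of its projection plus the codimension. -/
theorem ofReal_max_sub_codim_le_dimH_image {n : ℕ} (W : Submodule ℝ (EuclideanSpace ℝ (Fin n)))
    {C : Set (EuclideanSpace ℝ (Fin n))} {d : ℝ} (hC : dimH C = ENNReal.ofReal d) :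
    ENNReal.ofReal (max 0 (d - (codim W : ℝ))) ≤ dimH (W.orthogonalProjectionOnto '' C) := by
  have h := (dimH_mono (Set.subset_preimage_image W.orthogonalProjectionOnto C)).trans
    (dimH_preimage_linearMap_le W.orthogonalProjectionOnto.toLinearMap
      (W.orthogonalProjectionOnto '' C))
  rw [Submodule.ker_orthogonalProjectionOnto, ← codim_eq_finrank_orthogonal, hC] at h
  rcases le_total (d - (codim W : ℝ)) 0 with h0 | h0
  · rw [max_eq_left h0, ENNReal.ofReal_zero]; exact zero_le
  · rw [max_eq_right h0, ENNReal.ofReal_sub _ (Nat.cast_nonneg _), ENNReal.ofReal_natCast]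
    exact tsub_le_iff_right.2 h

/-- The lower bound for sets containing scaled copies. -/
theorem copiesDim_le_dimH {n : ℕ} {S : Set (EuclideanSpace ℝ (Fin n))}
    {T : ℕ → Set (EuclideanSpace ℝ (Fin n))} {V : ℕ → AffineSubspace ℝ (EuclideanSpace ℝ (Fin n))}
    (hS : S = ⋃ i, T i) (hne : ∀ i, (T i).Nonempty)
    (hTV : ∀ i, T i ⊆ (V i : Set (EuclideanSpace ℝ (Fin n)))) {d : ℝ}
    {C A : Set (EuclideanSpace ℝ (Fin n))} (hCne : C.Nonempty) (hC : dimH C = ENNReal.ofReal d)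
    (hA : ContainsScaledCopies S C A) : copiesDim T V d ≤ dimH A := by
  refine iSup_le fun i => ?_
  set W := spanPerp (V i) with hW
  refine (add_le_add_left (ofReal_max_sub_codim_le_dimH_image W hC) _).trans ?_
  have hproj : ∀ x (r : ℝ), ∀ s ∈ T i, W.orthogonalProjectionOnto (x + r • s) =
      W.orthogonalProjectionOnto x := fun x r s hs => by
    have hsW : s ∈ Wᗮ := by
      rw [hW, spanPerp_orthogonal]
      exact Submodule.subset_span (hTV i hs)
    rw [map_add, map_smul, Submodule.orthogonalProjectionOnto_apply_of_mem_orthogonal hsW,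
      smul_zero, add_zero]
  have hsub : ∀ x ∈ C, ∃ r : ℝ, 0 < r ∧ scaledCopy x r (T i) ⊆
      A ∩ W.orthogonalProjectionOnto ⁻¹' {W.orthogonalProjectionOnto x} := fun x hx => by
    obtain ⟨r, hr, hrA⟩ := hA x hx
    refine ⟨r, hr, ?_⟩
    rintro _ ⟨s, hs, rfl⟩
    exact ⟨hrA ⟨s, hS ▸ Set.mem_iUnion.2 ⟨i, hs⟩, rfl⟩, hproj x r s hs⟩
  refine W.orthogonalProjectionOnto.toLinearMap.add_le_dimH_of_fibres ?_ (hCne.image _) ?_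
  · rintro _ ⟨x, hx, rfl⟩
    obtain ⟨r, hr, hrA⟩ := hsub x hx
    obtain ⟨s, hs⟩ := hne i
    have h := hrA ⟨s, hs, rfl⟩
    exact ⟨_, h.1, h.2⟩
  · rintro _ ⟨x, hx, rfl⟩
    obtain ⟨r, hr, hrA⟩ := hsub x hx
    rw [← dimH_scaledCopy x hr.ne' (T i)]
    exact dimH_mono hrA

/-- An affine subspace missing the origin lies in a hyperplane `φ = 1`, and the elements of its
span in the kernel of `φ` belong to its direction. -/
theorem exists_linearMap_eq_one_of_zero_notMem {E : Type*} [AddCommGroup E] [Module ℝ E]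
    {V : AffineSubspace ℝ E} (h0 : (0 : E) ∉ V) (hne : (V : Set E).Nonempty) :
    ∃ φ : E →ₗ[ℝ] ℝ, (∀ x ∈ V, φ x = 1) ∧
      ∀ x ∈ Submodule.span ℝ (V : Set E), φ x = 0 → x ∈ V.direction := by
  obtain ⟨v, hv⟩ := hne
  have hv0 : v ∉ V.direction := fun h => h0 <| by
    simpa using AffineSubspace.vadd_mem_of_mem_direction (V.direction.neg_mem h) hv
  obtain ⟨ψ, hψv, hψ⟩ := Submodule.exists_le_ker_of_notMem hv0
  have hφ : ∀ x ∈ V.direction, ((ψ v)⁻¹ • ψ) x = 0 := fun x hx => by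
    have : ψ x = 0 := hψ hx
    simp [this]
  have hφv : ((ψ v)⁻¹ • ψ) v = 1 := by simp [hψv]
  have hsub : ∀ x ∈ V, x - v ∈ V.direction := fun x hx => AffineSubspace.vsub_mem_direction hx hv
  refine ⟨(ψ v)⁻¹ • ψ, fun x hx => ?_, fun x hx hx0 => ?_⟩
  · have := hφ _ (hsub x hx)
    rw [map_sub, hφv] at this
    linarith
  · have hspan : Submodule.span ℝ (V : Set E) ≤ V.direction ⊔ Submodule.span ℝ {v} := by
      refine Submodule.span_le.2 fun y hy => ?_
      exact Submodule.mem_sup.2 ⟨y - v, hsub y hy, v, Submodule.mem_span_singleton_self v,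
        sub_add_cancel y v⟩
    obtain ⟨y, hy, z, hz, rfl⟩ := Submodule.mem_sup.1 (hspan hx)
    obtain ⟨a, rfl⟩ := Submodule.mem_span_singleton.1 hz
    rw [map_add, map_smul, hφ y hy, hφv, zero_add, smul_eq_mul, mul_one] at hx0
    rw [hx0, zero_smul, add_zero]
    exact hy

theorem span_le_direction_of_zero_mem {E : Type*} [AddCommGroup E] [Module ℝ E]
    {V : AffineSubspace ℝ E} (h0 : (0 : E) ∈ V) :
    Submodule.span ℝ (V : Set E) ≤ V.direction :=
  Submodule.span_le.2 fun x hx => by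
    simpa using AffineSubspace.vsub_mem_direction hx h0

theorem preimage_add_left_mem_residual {Z : Set ℝ} (hZ : Z ∈ residual ℝ) (a : ℝ) :
    (fun r : ℝ => a + r) ⁻¹' Z ∈ residual ℝ := by
  obtain ⟨Z', hZZ, hG, hd⟩ := mem_residual.1 hZ
  exact mem_residual.2 ⟨_, Set.preimage_mono hZZ, hG.preimage (continuous_const.add continuous_id),
    hd.preimage (Homeomorph.addLeft a).isOpenMap⟩

/-- For generic scales, all scaled copies of a piece lie in a set of the least possible
dimension. -/
theorem exists_residual_scales {n : ℕ} {C : Set (EuclideanSpace ℝ (Fin n))} (hC : IsCompact C)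
    (V : AffineSubspace ℝ (EuclideanSpace ℝ (Fin n)))
    (hV : (V : Set (EuclideanSpace ℝ (Fin n))).Nonempty) :
    ∃ B : Set (EuclideanSpace ℝ (Fin n)),
      dimH B ≤ dimH ((spanPerp V).orthogonalProjectionOnto '' C) +
        Module.finrank ℝ V.direction ∧
      ∀ x ∈ C, ∀ᶠ r in residual ℝ, ∀ s ∈ V, x + r • s ∈ B := by
  set W := spanPerp V with hW
  set E := W.orthogonalProjectionOnto '' C with hE
  have hEc : IsCompact E := hC.image W.orthogonalProjectionOnto.continuous
  have hWp : Wᗮ = Submodule.span ℝ (V : Set (EuclideanSpace ℝ (Fin n))) := spanPerp_orthogonal V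
  have hproj : ∀ x ∈ C, ∀ (r : ℝ), ∀ s ∈ V, W.orthogonalProjectionOnto (x + r • s) ∈ E :=
    fun x hx r s hs => by
      have hsW : s ∈ Wᗮ := by
        rw [hWp]
        exact Submodule.subset_span hs
      rw [map_add, map_smul, Submodule.orthogonalProjectionOnto_apply_of_mem_orthogonal hsW,
        smul_zero, add_zero]
      exact Set.mem_image_of_mem _ hx
  -- If `0 ∈ V`, the span is the direction of `V` and every scale works. Otherwise `φ` detects the
  -- extra dimension, and `B` restricts it to the generic set `Z`.
  by_cases h0 : (0 : EuclideanSpace ℝ (Fin n)) ∈ V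
  · refine ⟨W.orthogonalProjectionOnto.toLinearMap ⁻¹' E,
      (dimH_preimage_linearMap_le _ _).trans ?_,
      fun x hx => Eventually.of_forall fun r s hs => hproj x hx r s hs⟩
    gcongr
    rw [Submodule.ker_orthogonalProjectionOnto, hWp]
    exact Submodule.finrank_mono (span_le_direction_of_zero_mem h0)
  · obtain ⟨φ, hφ1, hφ0⟩ := exists_linearMap_eq_one_of_zero_notMem h0 hV
    obtain ⟨Z, hZ, hEZ⟩ := hEc.exists_residual_dimH_prod_le
    refine ⟨(W.orthogonalProjectionOnto.toLinearMap.prod φ) ⁻¹' (E ×ˢ Z),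
      (dimH_preimage_linearMap_le _ _).trans ?_, fun x hx => ?_⟩
    · gcongr
      refine Submodule.finrank_mono fun y hy => ?_
      rw [LinearMap.ker_prod, Submodule.mem_inf] at hy
      refine hφ0 y ?_ hy.2
      rw [← hWp, ← Submodule.ker_orthogonalProjectionOnto]
      exact hy.1
    · filter_upwards [preimage_add_left_mem_residual hZ (φ x)] with r hr s hs
      refine ⟨hproj x hx r s hs, ?_⟩
      simpa [hφ1 s hs] using hr

end ScaledCopies

/-- `S` is the union of the pieces `T i ⊆ V i`. The first half of the conclusion is the lower bound
for all nonempty `d`-dimensional sets of centres, the second says that it is attained,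
even with a compact set of centres. -/
theorem corollary2p5 (n : ℕ) (S : Set (EuclideanSpace ℝ (Fin n)))
    (T : ℕ → Set (EuclideanSpace ℝ (Fin n)))
    (V : ℕ → AffineSubspace ℝ (EuclideanSpace ℝ (Fin n)))
    (hS : S = ⋃ i, T i)
    (hne : ∀ i, (T i).Nonempty)
    (hTV : ∀ i, T i ⊆ (V i : Set (EuclideanSpace ℝ (Fin n))))
    (hdim : ∀ i, dimH (T i) = (Module.finrank ℝ (V i).direction : ℝ≥0∞))
    (d : ℝ) (hd : d ∈ Set.Icc (0 : ℝ) n) :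
    (∀ C A : Set (EuclideanSpace ℝ (Fin n)), C.Nonempty → dimH C = ENNReal.ofReal d →
      ContainsScaledCopies S C A → copiesDim T V d ≤ dimH A) ∧
    (∃ C A : Set (EuclideanSpace ℝ (Fin n)), C.Nonempty ∧ IsCompact C ∧
      dimH C = ENNReal.ofReal d ∧ ContainsScaledCopies S C A ∧ dimH A = copiesDim T V d) := by

  have hlower : ∀ C A : Set (EuclideanSpace ℝ (Fin n)), C.Nonempty →
      dimH C = ENNReal.ofReal d → ContainsScaledCopies S C A → copiesDim T V d ≤ dimH A :=
    fun C A hCne hC hA => copiesDim_le_dimH hS hne hTV hCne hC hA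
  refine ⟨hlower, ?_⟩
  obtain ⟨C, hCne, hCc, hCd, hCproj⟩ := exists_isCompact_dimH_eq_and_dimH_projection_le
    (fun i => spanPerp (V i)) hd.1 (by simpa using hd.2)
  choose B hB hBr using fun i => exists_residual_scales hCc (V i) ((hne i).mono (hTV i))
  have hscale : ∀ x ∈ C, ∃ r : ℝ, 0 < r ∧ ∀ i, ∀ s ∈ V i, x + r • s ∈ B i := fun x hx => by
    -- Countably many residual conditions hold together on a residual set, which is dense and so
    -- contains a positive scale.
    have hres : {r : ℝ | ∀ i, ∀ s ∈ V i, x + r • s ∈ B i} ∈ residual ℝ :=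
      eventually_countable_forall.2 fun i => hBr i x hx
    obtain ⟨r, hr, hr0⟩ := (dense_of_mem_residual hres).exists_gt 0
    exact ⟨r, hr0, hr⟩
  choose! r hr0 hrB using hscale
  have hcopies : ContainsScaledCopies S C (⋃ x ∈ C, scaledCopy x (r x) S) := fun x hx =>
    ⟨r x, hr0 x hx, Set.subset_biUnion_of_mem (u := fun x => scaledCopy x (r x) S) hx⟩
  refine ⟨C, ⋃ x ∈ C, scaledCopy x (r x) S, hCne, hCc, hCd, hcopies,
    le_antisymm ?_ (hlower _ _ hCne hCd hcopies)⟩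
  have hsub : (⋃ x ∈ C, scaledCopy x (r x) S) ⊆ ⋃ i, B i := by
    refine Set.iUnion₂_subset fun x hx => ?_
    rintro _ ⟨s, hs, rfl⟩
    obtain ⟨i, hi⟩ := Set.mem_iUnion.1 (hS ▸ hs)
    exact Set.mem_iUnion.2 ⟨i, hrB x hx i s (hTV i hi)⟩
  refine (dimH_mono hsub).trans ?_
  rw [dimH_iUnion]
  refine iSup_mono fun i => (hB i).trans ?_
  -- The sets `B i` hold copies of all of `V i`; `dim S_i = dim V_i` makes this cost no more than
  -- copies of `S_i`.
  rw [hdim i, codim_eq_finrank_orthogonal]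
  exact add_le_add_left (hCproj i) _
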